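/- Let $0<\alpha<1$, let $\Omega\subset\mathbb{R}^d$ ($d\in\{1,2,3\}$) be a bounded domain with a conforming triangulation into intervals/triangles/tetrahedra, and let $X_h$ be the space of continuous functions on $\overline\Omega$ that are affine on each simplex and vanish on $\partial\Omega$. Write $\langle\cdot,\cdot\rangle$ and $\|\cdot\|$ for the inner product and norm of $L^2(\Omega)$, $\omega_\beta(s)=s^{\beta-1}/\Gamma(\beta)$ and $E_\alpha(z)=\sum_{k\ge0}z^k/\Gamma(1+k\alpha)$. Let $0=t_0<t_1<\dots<t_N=T$ ($N\ge 1$), $\tau_k=t_k-t_{k-1}$, $\tau=\max_{1\le k\le N}\tau_k$, $\rho_k=\tau_k/\tau_{k+1}$, $t_{n-\theta}=\theta t_{n-1}+(1-\theta)t_n$, $t_{k-1/2}=(t_{k-1}+t_k)/2$, and $v^{n-\theta}=\theta v^{n-1}+(1-\theta)v^n$ for a sequence $(v^n)$. Define $$a^{(n)}_{n-k}=\frac1{\tau_k}\int_{t_{k-1}}^{\min\{t_k,t_{n-\theta}\}}\omega_{1-\alpha}(t_{n-\theta}-s)\,ds\quad(1\le k\le n),$$ $$b^{(n)}_{n-k}=\frac{2}{\tau_k(\tau_k+\tau_{k+1})}\int_{t_{k-1}}^{t_k}(s-t_{k-1/2})\,\omega_{1-\alpha}(t_{n-\theta}-s)\,ds\quad(1\le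 k\le n-1),$$ and $A^{(1)}_0=a^{(1)}_0$, while for $n\ge2$ $$A^{(n)}_{n-k}=\begin{cases}a^{(n)}_0+\rho_{n-1}b^{(n)}_1,&k=n,\\ a^{(n)}_{n-k}+\rho_{k-1}b^{(n)}_{n-k+1}-b^{(n)}_{n-k},&2\le k\le n-1,\\ a^{(n)}_{n-1}-b^{(n)}_{n-1},&k=1.\end{cases}$$ The complementary kernels are defined recursively by $P^{(n)}_0=1/A^{(n)}_0$ and $$P^{(n)}_{n-j}=\frac1{A^{(j)}_0}\sum_{k=j+1}^n\bigl(A^{(k)}_{k-j-1}-A^{(k)}_{k-j}\bigr)P^{(n)}_{n-k},\qquad 1\le j\le n-1.$$ Let $\kappa\in\mathbb{R}$, $\kappa_+=\max\{\kappa,0\}$, $u_{0h}\in X_h$, $f(t_{n-\theta})\in L^2(\Omega)$ for $1\le n\le N$, and let $u_h^0=u_{0h}$ and $u_h^1,\dots,u_h^N\in X_h$ solve the fully discrete fractional Crank--Nicolson Galerkin scheme $$\Bigl\langle\sum_{k=1}^nA^{(n)}_{n-k}(u_h^k-u_h^{k-1}),\chi\Bigr\rangle+\langle\nabla u_h^{n-\theta},\nabla\chi\rangle=\kappa\langle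 u_h^{n-\theta},\chi\rangle+\langle f(t_{n-\theta}),\chi\rangle\qquad\text{for all }\chi\in X_h,\ 1\le n\le N.$$ **Theorem.** Assume condition M1: $\theta=\alpha/2$ and $\rho_k\le 7/4$ for $1\le k\le N-1$. If $\kappa>0$, assume moreover that $\tau\le\bigl(11\,\Gamma(2-\alpha)\,\kappa_+\bigr)^{-1/\alpha}$ (there is no restriction on $\tau$ if $\kappa\le0$). Then, for $1\le n\le N$, $$\|u_h^n\|\le 2E_\alpha(20\kappa_+t_n^\alpha)\Bigl(\|u_{0h}\|+2\max_{1\le k\le n}\sum_{j=1}^kP^{(k)}_{k-j}\|f(t_{j-\theta})\|\Bigr)$$ $$\le 2E_\alpha(20\kappa_+t_n^\alpha)\Bigl(\|u_{0h}\|+6\,\Gamma(1-\alpha)\max_{1\le j\le n}\bigl\{t_j^\alpha\|f(t_{j-\theta})\|\bigr\}\Bigr).$$ -/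

import Mathlib

namespace FracCN

noncomputable section

/-! ### Special functions -/

/-- The fractional kernel `ω_β(t) = t^(β-1) / Γ(β)`. -/
def omega (β t : ℝ) : ℝ := t ^ (β - 1) / Real.Gamma β

/-- The Mittag-Leffler function `E_α(z) = ∑_{k ≥ 0} z^k / Γ(1 + kα)`. -/
def mittagLeffler (α z : ℝ) : ℝ := ∑' k : ℕ, z ^ k / Real.Gamma (1 + k * α)

/-- The maximum of `g k` over `1 ≤ k ≤ n`. -/
def maxUpTo (n : ℕ) (hn : 1 ≤ n) (g : ℕ → ℝ) : ℝ :=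
  (Finset.Icc 1 n).sup' (Finset.nonempty_Icc.2 hn) g

/-! ### Time meshes -/

/-- `t 0, …, t N` are time levels `0 = t_0 < t_1 < ⋯ < t_N` (the final time is `T = t N`). -/
def IsTimeMesh (N : ℕ) (t : ℕ → ℝ) : Prop :=
  t 0 = 0 ∧ ∀ k < N, t k < t (k + 1)

/-- The step size `τ_k = t_k - t_{k-1}`, for `k ≥ 1`. -/
def step (t : ℕ → ℝ) (k : ℕ) : ℝ := t k - t (k - 1)

/-- The local step-size ratio `ρ_k = τ_k / τ_{k+1}`, for `k ≥ 1`. -/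
def ratio (t : ℕ → ℝ) (k : ℕ) : ℝ := step t k / step t (k + 1)

/-- The offset time `t_{n-θ} = θ t_{n-1} + (1-θ) t_n`, for `n ≥ 1`. -/
def offsetTime (θ : ℝ) (t : ℕ → ℝ) (n : ℕ) : ℝ := θ * t (n - 1) + (1 - θ) * t n

/-- Condition **M1**: `θ = α/2`, and the step-size ratios `ρ_1, …, ρ_{N-1}` are at most `7/4`. -/
def CondM1 (α θ : ℝ) (N : ℕ) (t : ℕ → ℝ) : Prop :=
  θ = α / 2 ∧ ∀ k, 1 ≤ k → k + 1 ≤ N → ratio t k ≤ 7 / 4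

/-! ### The kernels of the nonuniform Alikhanov formula

Indices follow the usual notation: `coeffA α θ t n m` is `a^{(n)}_m`, so that `m = n - k`
corresponds to the subinterval `[t_{k-1}, t_k]` with `k = n - m`. Note that
`ϖ_n'(s) = ω_{1-α}(t_{n-θ} - s)`. -/

/-- `a^{(n)}_{n-k} = (1/τ_k) ∫_{t_{k-1}}^{min(t_k, t_{n-θ})} ω_{1-α}(t_{n-θ} - s) ds`,
`1 ≤ k ≤ n`. -/
def coeffA (α θ : ℝ) (t : ℕ → ℝ) (n m : ℕ) : ℝ :=
  1 / step t (n - m) *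
    ∫ s in (t (n - m - 1))..(min (t (n - m)) (offsetTime θ t n)),
      omega (1 - α) (offsetTime θ t n - s)

/-- `b^{(n)}_{n-k} = 2/(τ_k (τ_k + τ_{k+1})) ∫_{t_{k-1}}^{t_k} (s - t_{k-1/2}) ω_{1-α}(t_{n-θ} - s) ds`,
`1 ≤ k ≤ n-1`, where `t_{k-1/2} = (t_{k-1} + t_k)/2`. -/
def coeffB (α θ : ℝ) (t : ℕ → ℝ) (n m : ℕ) : ℝ :=
  2 / (step t (n - m) * (step t (n - m) + step t (n - m + 1))) *
    ∫ s in (t (n - m - 1))..(t (n - m)),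
      (s - (t (n - m - 1) + t (n - m)) / 2) * omega (1 - α) (offsetTime θ t n - s)

/-- The discrete convolution kernel `A^{(n)}_m`, `0 ≤ m ≤ n-1`: one has `A^{(1)}_0 = a^{(1)}_0`
and, for `n ≥ 2` and with `k = n - m`,
* `A^{(n)}_0 = a^{(n)}_0 + ρ_{n-1} b^{(n)}_1` (`k = n`),
* `A^{(n)}_{n-k} = a^{(n)}_{n-k} + ρ_{k-1} b^{(n)}_{n-k+1} - b^{(n)}_{n-k}` (`2 ≤ k ≤ n-1`),
* `A^{(n)}_{n-1} = a^{(n)}_{n-1} - b^{(n)}_{n-1}` (`k = 1`). -/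
def kernelA (α θ : ℝ) (t : ℕ → ℝ) (n m : ℕ) : ℝ :=
  if n = 1 then coeffA α θ t 1 0
  else if m = 0 then coeffA α θ t n 0 + ratio t (n - 1) * coeffB α θ t n 1
  else if m = n - 1 then coeffA α θ t n (n - 1) - coeffB α θ t n (n - 1)
  else coeffA α θ t n m + ratio t (n - m - 1) * coeffB α θ t n (m + 1) - coeffB α θ t n m

/-- The complementary kernel `P^{(n)}_m` of a family `A n m = A^{(n)}_m`, defined recursively by
`P^{(n)}_0 = 1 / A^{(n)}_0` and, for `1 ≤ j ≤ n-1`,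
`P^{(n)}_{n-j} = (1 / A^{(j)}_0) ∑_{k=j+1}^n (A^{(k)}_{k-j-1} - A^{(k)}_{k-j}) P^{(n)}_{n-k}`.
In the second clause `m + 1 = n - j`, and the summation index is `i = n - k ∈ {0, …, m}`. -/
def kernelP (A : ℕ → ℕ → ℝ) (n : ℕ) : ℕ → ℝ
  | 0 => 1 / A n 0
  | m + 1 => 1 / A (n - (m + 1)) 0 *
      ∑ i : Fin (m + 1), (A (n - i) (m - i) - A (n - i) (m + 1 - i)) * kernelP A n i
  termination_by m => m
  decreasing_by exact i.isLt

/-! ### The spatial discretization -/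

/-- The underlying space `ℝ^d`. -/
abbrev Space (d : ℕ) : Type := EuclideanSpace ℝ (Fin d)

/-- A (conforming) triangulation of `Ω ⊆ ℝ^d`: a finite simplicial complex, all of whose faces
are faces of `d`-simplices (intervals for `d = 1`, triangles for `d = 2`, tetrahedra for `d = 3`),
that covers exactly the closure of `Ω`. -/
structure IsTriangulation {d : ℕ} (K : Geometry.SimplicialComplex ℝ (Space d))
    (Ω : Set (Space d)) : Prop where
  finite : K.faces.Finite
  pure : ∀ s ∈ K.faces, ∃ r ∈ K.faces, s ⊆ r ∧ r.card = d + 1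
  space_eq : K.space = closure Ω

/-- The finite element space `X_h`: continuous functions, affine on each `d`-simplex of the
triangulation, that vanish on `∂Ω`. A member is identified with its extension by zero to `ℝ^d`. -/
def femSpace {d : ℕ} (K : Geometry.SimplicialComplex ℝ (Space d)) (Ω : Set (Space d)) :
    Set (Space d → ℝ) :=
  {v | Continuous v ∧
    (∀ s ∈ K.faces, s.card = d + 1 →
      ∃ g : Space d →ᵃ[ℝ] ℝ, Set.EqOn v g (convexHull ℝ (s : Set (Space d)))) ∧
    ∀ x ∉ Ω, v x = 0}

/-- The `L²(Ω)` inner product `⟨u, v⟩ = ∫_Ω u v`. -/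
def l2Inner {d : ℕ} (Ω : Set (Space d)) (u v : Space d → ℝ) : ℝ :=
  ∫ x in Ω, u x * v x

/-- The `L²(Ω)` norm. -/
def l2Norm {d : ℕ} (Ω : Set (Space d)) (u : Space d → ℝ) : ℝ :=
  Real.sqrt (l2Inner Ω u u)

/-- The Dirichlet form `⟨∇u, ∇v⟩ = ∫_Ω ∇u ⬝ ∇v`. A function in the finite element space is affine
on each simplex, so that its classical gradient exists almost everywhere and is the weak one. -/
def gradInner {d : ℕ} (Ω : Set (Space d)) (u v : Space d → ℝ) : ℝ :=
  ∫ x in Ω, inner ℝ (gradient u x) (gradient v x)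

/-! ### The fully discrete scheme -/

/-- The discrete Caputo derivative
`(D_τ^α v)^{n-θ} = ∑_{k=1}^n A^{(n)}_{n-k} (v^k - v^{k-1})` of a sequence of functions. -/
def discreteCaputo {d : ℕ} (α θ : ℝ) (t : ℕ → ℝ) (v : ℕ → Space d → ℝ) (n : ℕ) :
    Space d → ℝ :=
  ∑ k ∈ Finset.Icc 1 n, kernelA α θ t n (n - k) • (v k - v (k - 1))

/-- The interpolated value `v^{n-θ} = θ v^{n-1} + (1-θ) v^n`. -/
def offsetValue {d : ℕ} (θ : ℝ) (v : ℕ → Space d → ℝ) (n : ℕ) : Space d → ℝ :=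
  θ • v (n - 1) + (1 - θ) • v n

/-- `u 0, …, u N` solve the fully discrete fractional Crank–Nicolson Galerkin scheme:
`u^n ∈ X_h` for all `n`, `u^0 = u_{0h}`, and for `1 ≤ n ≤ N` and all `χ ∈ X_h`,
`⟨(D_τ^α u)^{n-θ}, χ⟩ + ⟨∇u^{n-θ}, ∇χ⟩ = κ ⟨u^{n-θ}, χ⟩ + ⟨f(t_{n-θ}), χ⟩`. -/
structure IsSchemeSolution {d : ℕ} (Ω : Set (Space d))
    (K : Geometry.SimplicialComplex ℝ (Space d)) (α θ κ : ℝ) (N : ℕ) (t : ℕ → ℝ)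
    (f : ℝ → Space d → ℝ) (u₀ : Space d → ℝ) (u : ℕ → Space d → ℝ) : Prop where
  mem : ∀ n ≤ N, u n ∈ femSpace K Ω
  init : u 0 = u₀
  eqn : ∀ n, 1 ≤ n → n ≤ N → ∀ χ ∈ femSpace K Ω,
    l2Inner Ω (discreteCaputo α θ t u n) χ + gradInner Ω (offsetValue θ u n) χ =
      κ * l2Inner Ω (offsetValue θ u n) χ + l2Inner Ω (f (offsetTime θ t n)) χ

end

end FracCN

namespace FracCN

open Finset

/-! The proof is an energy argument followed by a discrete fractional Grönwall inequality.

Energy. Testing the scheme with its own offset value makes the Dirichlet term nonnegative. If the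
kernels `A` are positive, decreasing in `m`, and satisfy `(1 - θ) A_1 ≤ (1 - 2θ) A_0`, then
Alikhanov's inequality (`sum_mul_norm_sq_sub_le`) bounds the discrete derivative of `‖u‖²` by twice
the tested derivative. Hence it is at most `2κ₊ w² + 2 w ‖f‖`, where `w` is the offset value of the
norms (`IsSchemeSolution.energy_le`).

Kernels. Monotonicity follows by interleaving: consecutive kernels are separated by a value of
`ω_{1-α}` at a mesh point (`kernelA_le_omega`, `coeffB_le_sub`). The starting inequality is where `θ
= α/2` enters (`kernelA_one_le`). The ratio bound `7/4` also gives `A ≥ 4/11` times the mean of the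
exact kernel (`integral_omega_le_kernelA`).

Grönwall. The complementary kernels `P` invert convolution with `A` (`sum_kernelP_mul_sum`), so
applying them to the energy inequality leaves `‖u^k‖² - ‖u^0‖²` on the left. Since `A` dominates the
exact kernel, `P` behaves like a fractional integral: up to a constant it sends `ω_{1+kα}` to
`ω_{1+(k+1)α}` (`sum_kernelP_mul_powTerm_le`). Summing the Mittag-Leffler series term by term yields
a supersolution (`sum_kernelP_mul_mittagLeffler_le`), and `discrete_gronwall` compares the solution
with it. The step restriction absorbs the implicit term `P_0`. The second bound follows from the
moment of `P` against `ω_{1-α}` (`sum_kernelP_mul_omega_le`). -/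

theorem sum_Icc_one_eq_sum_range {M : Type*} [AddCommMonoid M] (n : ℕ) (f : ℕ → M) :
    ∑ k ∈ Icc 1 n, f k = ∑ m ∈ range n, f (n - m) := by
  refine sum_nbij' (fun k => n - k) (fun m => n - m) ?_ ?_ ?_ ?_ ?_ <;>
    simp only [mem_Icc, mem_range] <;> intro a ha
  · omega
  · omega
  · omega
  · omega
  · congr 1; omega

/-! ### Complementary kernels -/

section Complementary

variable {A : ℕ → ℕ → ℝ} {n : ℕ}

theorem kernelP_zero : kernelP A n 0 = 1 / A n 0 := by
  rw [kernelP]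

theorem kernelP_succ (m : ℕ) :
    kernelP A n (m + 1) = 1 / A (n - (m + 1)) 0 *
      ∑ i ∈ range (m + 1), (A (n - i) (m - i) - A (n - i) (m + 1 - i)) * kernelP A n i := by
  rw [kernelP, Finset.sum_range]

/-- The recursion for `P` says exactly that the sums for `m` and `m + 1` agree, so all of them equal
the one for `m = 0`. -/
theorem sum_range_kernelP_mul (hA : ∀ j, 1 ≤ j → j ≤ n → A j 0 ≠ 0) (m : ℕ) (hm : m < n) :
    ∑ i ∈ range (m + 1), kernelP A n i * A (n - i) (m - i) = 1 := by
  induction m with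
  | zero => simp [kernelP_zero, hA n hm le_rfl]
  | succ m ih =>
    have h0 := hA (n - (m + 1)) (by omega) (by omega)
    rw [sum_range_succ, kernelP_succ, Nat.sub_self]
    have h1 : ∀ S : ℝ, 1 / A (n - (m + 1)) 0 * S * A (n - (m + 1)) 0 = S := by
      intro S; field_simp
    rw [h1, ← sum_add_distrib, ← ih (by omega)]
    exact sum_congr rfl fun i _ => by ring

theorem kernelP_nonneg (hpos : ∀ j, 1 ≤ j → j ≤ n → 0 < A j 0)
    (hanti : ∀ j m, j ≤ n → m + 1 < j → A j (m + 1) ≤ A j m) (m : ℕ) (hm : m < n) :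
    0 ≤ kernelP A n m := by
  induction m using Nat.strong_induction_on with
  | _ m ih =>
    rcases m with _ | m
    · rw [kernelP_zero]
      exact (one_div_pos.2 (hpos n hm le_rfl)).le
    · rw [kernelP_succ]
      refine mul_nonneg (one_div_pos.2 (hpos _ (by omega) (by omega))).le
        (sum_nonneg fun i hi => ?_)
      have hi' := mem_range.1 hi
      refine mul_nonneg ?_ (ih i (by omega) (by omega))
      have h := hanti (n - i) (m - i) (by omega) (by omega)
      rw [show m - i + 1 = m + 1 - i by omega] at h
      linarith

theorem sum_Icc_kernelP_mul (hA : ∀ j, 1 ≤ j → j ≤ n → A j 0 ≠ 0) (k : ℕ) (hk : 1 ≤ k)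
    (hkn : k ≤ n) : ∑ j ∈ Icc k n, kernelP A n (n - j) * A j (j - k) = 1 := by
  rw [← sum_range_kernelP_mul hA (n - k) (by omega)]
  refine sum_nbij' (fun j => n - j) (fun i => n - i) ?_ ?_ ?_ ?_ ?_ <;>
    simp only [mem_Icc, mem_range] <;> intro a ha
  · omega
  · omega
  · omega
  · omega
  · rw [show n - (n - a) = a by omega, show n - k - (n - a) = a - k by omega]

/-- The complementary kernels invert the discrete convolution with `A`. -/
theorem sum_kernelP_mul_sum (hA : ∀ j, 1 ≤ j → j ≤ n → A j 0 ≠ 0) (D : ℕ → ℝ) :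
    ∑ j ∈ Icc 1 n, kernelP A n (n - j) * ∑ k ∈ Icc 1 j, A j (j - k) * D k =
      ∑ k ∈ Icc 1 n, D k := by
  simp_rw [mul_sum]
  rw [sum_comm' (t' := Icc 1 n) (s' := fun k => Icc k n)
    (by intro x y; simp only [mem_Icc]; omega)]
  refine sum_congr rfl fun k hk => ?_
  have hk' := mem_Icc.1 hk
  simp_rw [← mul_assoc]
  rw [← sum_mul, sum_Icc_kernelP_mul hA k hk'.1 hk'.2, one_mul]

end Complementary

/-! ### The energy inequality -/

/-- Summation by parts: as `q + θ²Y ≥ 0` and `a` decreases, a lower bound `a (M + 1) * (q (M + 2) +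
θ²Y)` for the partial sums propagates by induction. The hypothesis on `a 0` and `a 1` starts it. -/
theorem sum_mul_sub_nonneg {θ Y : ℝ} (hθ : 0 ≤ θ) (hθ₁ : θ ≤ 1 / 2) (hY : 0 ≤ Y) {n : ℕ}
    {a q : ℕ → ℝ} (hpos : ∀ m < n, 0 ≤ a m) (hanti : ∀ m, m + 1 < n → a (m + 1) ≤ a m)
    (hstart : 1 < n → (1 - θ) * a 1 ≤ (1 - 2 * θ) * a 0)
    (hq0 : q 0 = 0) (hq1 : q 1 = (1 - 2 * θ) * Y) (hq : ∀ m, -(θ ^ 2 * Y) ≤ q m) :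
    0 ≤ ∑ m ∈ range n, a m * (q (m + 1) - q m) := by
  rcases Nat.lt_trichotomy n 1 with h | h | h
  · obtain rfl : n = 0 := by omega
    simp
  · subst h
    simp only [sum_range_one, zero_add, hq0, hq1, sub_zero]
    exact mul_nonneg (hpos 0 one_pos) (mul_nonneg (by linarith) hY)
  · have key : ∀ M, M + 2 ≤ n → a (M + 1) * (q (M + 2) + θ ^ 2 * Y) ≤
        ∑ m ∈ range (M + 2), a m * (q (m + 1) - q m) := by
      intro M
      induction M with
      | zero =>
        intro _
        have h1 := hpos 1 h
        -- The factor comes from `q 1 + θ²Y = (1 - θ)² Y`.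
        have h2 : (1 - θ) ^ 2 * a 1 ≤ (1 - 2 * θ) * a 0 := by
          refine le_trans ?_ (hstart h)
          have : (1 - θ) ^ 2 ≤ 1 - θ := by nlinarith
          exact mul_le_mul_of_nonneg_right this h1
        have h3 := mul_le_mul_of_nonneg_right h2 hY
        simp only [sum_range_succ, sum_range_zero, zero_add, hq0, hq1]
        nlinarith
      | succ M ih =>
        intro hM
        rw [sum_range_succ]
        have h1 := ih (by omega)
        have h2 := hanti (M + 1) (by omega)
        have h3 := mul_le_mul_of_nonneg_right h2
          (show 0 ≤ q (M + 2) + θ ^ 2 * Y by linarith [hq (M + 2)])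
        have e : M + 1 + 1 = M + 2 := rfl
        have e2 : M + 1 + 2 = M + 2 + 1 := rfl
        rw [e] at h3
        rw [e, e2]
        nlinarith
    obtain ⟨M, rfl⟩ : ∃ M, n = M + 2 := ⟨n - 2, by omega⟩
    refine le_trans ?_ (key M le_rfl)
    exact mul_nonneg (hpos _ (by omega)) (by linarith [hq (M + 2)])

section Energy

variable {H : Type*} [NormedAddCommGroup H] [InnerProductSpace ℝ H]

/-- Alikhanov's inequality for discrete convolution derivatives. -/
theorem sum_mul_norm_sq_sub_le {θ : ℝ} (hθ : 0 ≤ θ) (hθ₁ : θ ≤ 1 / 2) {n : ℕ}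
    {a : ℕ → ℝ} (hpos : ∀ m < n, 0 ≤ a m) (hanti : ∀ m, m + 1 < n → a (m + 1) ≤ a m)
    (hstart : 1 < n → (1 - θ) * a 1 ≤ (1 - 2 * θ) * a 0) (x : ℕ → H) :
    ∑ k ∈ Icc 1 n, a (n - k) * (‖x k‖ ^ 2 - ‖x (k - 1)‖ ^ 2) ≤
      2 * inner ℝ (∑ k ∈ Icc 1 n, a (n - k) • (x k - x (k - 1)))
        (θ • x (n - 1) + (1 - θ) • x n) := by
  set z : ℕ → H := fun m => x n - x (n - m) with hz
  -- With `x (n - m) = x n - z m` and offset value `x n - θ • z 1`, the difference of the two sides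
  -- is `∑ a m (q (m+1) - q m)`. Completing the square, `q m = ‖z m - θ • z 1‖² - θ² ‖z 1‖²`.
  set q : ℕ → ℝ := fun m => ‖z m‖ ^ 2 - 2 * θ * inner ℝ (z m) (z 1) with hq
  have h := sum_mul_sub_nonneg (Y := ‖z 1‖ ^ 2) (q := q) hθ hθ₁ (sq_nonneg _) hpos hanti hstart
    (by simp [hq, hz]) (by simp only [hq, real_inner_self_eq_norm_sq]; ring) (by
      intro m
      have h1 : 0 ≤ ‖z m - θ • z 1‖ ^ 2 := sq_nonneg _
      rw [norm_sub_sq_real, inner_smul_right, norm_smul, mul_pow, Real.norm_eq_abs, sq_abs] at h1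
      simp only [hq]
      linarith)
  rw [← sub_nonneg]
  refine h.trans_eq ?_
  rw [sum_inner, mul_sum, ← sum_sub_distrib, sum_Icc_one_eq_sum_range]
  refine sum_congr rfl fun m hm => ?_
  have hm' := mem_range.1 hm
  rw [show n - (n - m) = m by omega, show n - m - 1 = n - (m + 1) by omega]
  simp only [hq, hz, inner_smul_left, inner_add_right, inner_smul_right, inner_sub_left,
    inner_sub_right, ← real_inner_self_eq_norm_sq, conj_trivial]
  rw [real_inner_comm (x n) (x (n - m)), real_inner_comm (x n) (x (n - (m + 1)))]
  ring

end Energy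

/-! ### The discrete Grönwall inequality -/

/-- `E` is a supersolution of the linear problem. At a new strict maximum `v k`, one factor `w j ≤ v
k` of the quadratic bound can be divided out, which makes it linear; induction then bounds the
history. -/
theorem discrete_gronwall {A : ℕ → ℕ → ℝ} {n : ℕ} (hpos : ∀ j, 1 ≤ j → j ≤ n → 0 < A j 0)
    (hanti : ∀ j m, j ≤ n → m + 1 < j → A j (m + 1) ≤ A j m)
    {θ Λ F : ℝ} (hθ : 0 ≤ θ) (hθ₁ : θ ≤ 1) (hΛ : 0 ≤ Λ) {v g E : ℕ → ℝ}
    (hv : ∀ k, 0 ≤ v k) (hg : ∀ k, 0 ≤ g k)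
    (hE : ∀ j k, j ≤ k → k ≤ n → E j ≤ E k) (hE₁ : 1 ≤ E 0)
    (hEP : ∀ k, 1 ≤ k → k ≤ n →
      2 * Λ * ∑ j ∈ Icc 1 (k - 1), kernelP A k (k - j) * E j ≤ E k - 1)
    (hP₀ : ∀ k, 1 ≤ k → k ≤ n → kernelP A k 0 * Λ ≤ 1 / 2)
    (hineq : ∀ j, 1 ≤ j → j ≤ n →
      ∑ k ∈ Icc 1 j, A j (j - k) * (v k ^ 2 - v (k - 1) ^ 2) ≤
        Λ * (θ * v (j - 1) + (1 - θ) * v j) ^ 2 + (θ * v (j - 1) + (1 - θ) * v j) * g j)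
    (hF₀ : v 0 ≤ F)
    (hF : ∀ k, 1 ≤ k → k ≤ n → v 0 + ∑ j ∈ Icc 1 k, kernelP A k (k - j) * g j ≤ F) :
    ∀ k ≤ n, v k ≤ 2 * E k * F := by
  have hFn : 0 ≤ F := (hv 0).trans hF₀
  have hEone : ∀ k ≤ n, 1 ≤ E k := fun k hk => hE₁.trans (hE 0 k (Nat.zero_le _) hk)
  intro k
  induction k using Nat.strong_induction_on with
  | _ k ih =>
  intro hk
  rcases Nat.eq_zero_or_pos k with rfl | hk0
  · nlinarith
  -- If `v k` is not a new strict maximum, it inherits an earlier bound because `E` is monotone.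
  by_cases hcase : ∃ l < k, v k ≤ v l
  · obtain ⟨l, hl, hvl⟩ := hcase
    have h1 := ih l hl (by omega)
    have h2 := mul_le_mul_of_nonneg_right (hE l k hl.le hk) hFn
    linarith
  push Not at hcase
  have hvk : 0 < v k := (hv 0).trans_lt (hcase 0 hk0)
  set w : ℕ → ℝ := fun j => θ * v (j - 1) + (1 - θ) * v j with hw
  have hPn : ∀ j, 1 ≤ j → j ≤ k → 0 ≤ kernelP A k (k - j) := fun j hj hjk =>
    kernelP_nonneg (fun i h1 h2 => hpos i h1 (h2.trans hk))
      (fun i m h1 h2 => hanti i m (h1.trans hk) h2) _ (by omega)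
  have hle : ∀ j ≤ k, v j ≤ v k := fun j hj => by
    rcases hj.lt_or_eq with h | rfl
    · exact (hcase j h).le
    · exact le_rfl
  have hw0 : ∀ j, 0 ≤ w j := fun j =>
    add_nonneg (mul_nonneg hθ (hv _)) (mul_nonneg (by linarith) (hv _))
  have hwk : ∀ j ≤ k, w j ≤ v k := fun j hj => by
    have h1 := mul_le_mul_of_nonneg_left (hle (j - 1) (by omega)) hθ
    have h2 := mul_le_mul_of_nonneg_left (hle j hj) (show 0 ≤ 1 - θ by linarith)
    simp only [hw]; linarith
  have htel : ∑ i ∈ Icc 1 k, (v i ^ 2 - v (i - 1) ^ 2) = v k ^ 2 - v 0 ^ 2 := by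
    clear_value w
    clear * -
    induction k with
    | zero => simp
    | succ k ih => rw [sum_Icc_succ_top (by omega), ih]; simp
  have h1 : v k ^ 2 - v 0 ^ 2 ≤
      ∑ j ∈ Icc 1 k, kernelP A k (k - j) * (Λ * w j + g j) * v k := by
    rw [← htel, ← sum_kernelP_mul_sum (fun j h1 h2 => (hpos j h1 (h2.trans hk)).ne')
      (fun i => v i ^ 2 - v (i - 1) ^ 2)]
    refine sum_le_sum fun j hj => ?_
    have hj' := mem_Icc.1 hj
    rw [mul_assoc]
    refine mul_le_mul_of_nonneg_left ((hineq j hj'.1 (hj'.2.trans hk)).trans ?_)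
      (hPn j hj'.1 hj'.2)
    have h2 := mul_le_mul_of_nonneg_left (hwk j hj'.2)
      (add_nonneg (mul_nonneg hΛ (hw0 j)) (hg j))
    simp only [hw] at h2 ⊢
    linarith
  rw [← sum_mul] at h1
  have h2 : v k ≤ v 0 + ∑ j ∈ Icc 1 k, kernelP A k (k - j) * (Λ * w j + g j) := by
    have h3 := hle 0 (Nat.zero_le k)
    have h4 := mul_le_mul_of_nonneg_left h3 (hv 0)
    refine le_of_mul_le_mul_right (?_ : _ * v k ≤ _ * v k) hvk
    nlinarith
  have h3 : ∑ j ∈ Icc 1 k, kernelP A k (k - j) * (Λ * w j + g j) =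
      Λ * ∑ j ∈ Icc 1 k, kernelP A k (k - j) * w j +
        ∑ j ∈ Icc 1 k, kernelP A k (k - j) * g j := by
    rw [mul_sum, ← sum_add_distrib]
    exact sum_congr rfl fun j _ => by ring
  have h4 : ∑ j ∈ Icc 1 k, kernelP A k (k - j) * w j =
      ∑ j ∈ Icc 1 (k - 1), kernelP A k (k - j) * w j + kernelP A k 0 * w k := by
    obtain ⟨l, rfl⟩ : ∃ l, k = l + 1 := ⟨k - 1, by omega⟩
    rw [sum_Icc_succ_top (by omega)]
    simp
  have h5 : ∑ j ∈ Icc 1 (k - 1), kernelP A k (k - j) * w j ≤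
      (∑ j ∈ Icc 1 (k - 1), kernelP A k (k - j) * E j) * (2 * F) := by
    rw [sum_mul]
    refine sum_le_sum fun j hj => ?_
    have hj' := mem_Icc.1 hj
    rw [mul_assoc]
    refine mul_le_mul_of_nonneg_left ?_ (hPn j hj'.1 (by omega))
    have h6 := ih (j - 1) (by omega) (by omega)
    have h7 := ih j (by omega) (by omega)
    have h8 := mul_le_mul_of_nonneg_right (hE (j - 1) j (by omega) (by omega)) hFn
    have h9 : v (j - 1) ≤ E j * (2 * F) := by linarith
    have h10 : v j ≤ E j * (2 * F) := by linarith
    have h11 := mul_le_mul_of_nonneg_left h9 hθ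
    have h12 := mul_le_mul_of_nonneg_left h10 (show 0 ≤ 1 - θ by linarith)
    simp only [hw]; linarith
  have h6 := mul_le_mul_of_nonneg_left h5 hΛ
  have h7 := mul_le_mul_of_nonneg_right (hEP k hk0 hk) hFn
  -- The implicit term is absorbed into half of `v k`; this produces the factor `2` in the
  -- conclusion.
  have h8 : Λ * (kernelP A k 0 * w k) ≤ 1 / 2 * v k := by
    have h9 := hPn k hk0 le_rfl
    rw [Nat.sub_self] at h9
    have h10 := mul_le_mul_of_nonneg_left (hwk k le_rfl) (mul_nonneg h9 hΛ)
    have h11 := mul_le_mul_of_nonneg_right (hP₀ k hk0 hk) hvk.le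
    linarith
  have h9 := hF k hk0 hk
  rw [h3, h4] at h2
  linarith

/-! ### Means and first moments of monotone and convex functions -/

section Moments

open MeasureTheory intervalIntegral

variable {w : ℝ → ℝ} {p q L : ℝ}

theorem integral_sub_midpoint (p q : ℝ) : ∫ s in p..q, (s - (p + q) / 2) = 0 := by
  simp only [intervalIntegral.integral_sub, intervalIntegrable_id, intervalIntegrable_const,
    integral_id, intervalIntegral.integral_const, smul_eq_mul]
  ring

theorem continuousOn_sub_midpoint_mul (hw : ContinuousOn w (Set.uIcc p q)) :
    ContinuousOn (fun s => (s - (p + q) / 2) * w s) (Set.uIcc p q) := by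
  fun_prop

theorem integral_sub_midpoint_mul_sub_const (hw : ContinuousOn w (Set.uIcc p q)) (c : ℝ) :
    ∫ s in p..q, (s - (p + q) / 2) * (w s - c) = ∫ s in p..q, (s - (p + q) / 2) * w s := by
  have h1 : (fun s => (s - (p + q) / 2) * (w s - c)) =
      fun s => (s - (p + q) / 2) * w s - (s - (p + q) / 2) * c := by ext s; ring
  have h2 : Continuous fun s : ℝ => (s - (p + q) / 2) * c := by fun_prop
  rw [h1, intervalIntegral.integral_sub (continuousOn_sub_midpoint_mul hw).intervalIntegrable
    (h2.intervalIntegrable _ _), intervalIntegral.integral_mul_const, integral_sub_midpoint,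
    zero_mul, sub_zero]

theorem integral_sub_midpoint_mul_nonneg (hpq : p ≤ q) (hw : ContinuousOn w (Set.uIcc p q))
    (hmono : MonotoneOn w (Set.Icc p q)) : 0 ≤ ∫ s in p..q, (s - (p + q) / 2) * w s := by
  rw [← integral_sub_midpoint_mul_sub_const hw (w ((p + q) / 2))]
  refine intervalIntegral.integral_nonneg hpq fun s hs => ?_
  have hmid : (p + q) / 2 ∈ Set.Icc p q := ⟨by linarith, by linarith⟩
  rcases le_total s ((p + q) / 2) with h | h
  · exact mul_nonneg_of_nonpos_of_nonpos (by linarith) (by linarith [hmono hs hmid h])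
  · exact mul_nonneg (by linarith) (by linarith [hmono hmid hs h])

theorem integral_sub_midpoint_mul_le (hpq : p ≤ q) (hw : ContinuousOn w (Set.uIcc p q))
    (hnn : ∀ s ∈ Set.Icc p q, 0 ≤ w s) :
    ∫ s in p..q, (s - (p + q) / 2) * w s ≤ (q - p) / 2 * ∫ s in p..q, w s := by
  rw [← intervalIntegral.integral_const_mul]
  refine intervalIntegral.integral_mono_on hpq
    (continuousOn_sub_midpoint_mul hw).intervalIntegrable
    (hw.intervalIntegrable.const_mul _) fun s hs => ?_
  exact mul_le_mul_of_nonneg_right (by linarith [hs.2]) (hnn s hs)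

/-- The first moment about the midpoint ignores constants, so `w` may be replaced by the nonnegative
`w - w p`. -/
theorem integral_sub_midpoint_mul_le_of_monotoneOn (hpq : p ≤ q)
    (hw : ContinuousOn w (Set.uIcc p q)) (hmono : MonotoneOn w (Set.Icc p q)) :
    ∫ s in p..q, (s - (p + q) / 2) * w s ≤
      (q - p) / 2 * ((∫ s in p..q, w s) - (q - p) * w p) := by
  have h := integral_sub_midpoint_mul_le (w := fun s => w s - w p) hpq
    (hw.sub continuousOn_const)
    (fun s hs => by linarith [hmono (Set.left_mem_Icc.2 hpq) hs hs.1])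
  rw [integral_sub_midpoint_mul_sub_const hw, intervalIntegral.integral_sub
    hw.intervalIntegrable intervalIntegrable_const, intervalIntegral.integral_const] at h
  exact h

theorem integral_le_of_slope_le (hpq : p ≤ q) (hw : ContinuousOn w (Set.uIcc p q))
    (hL : ∀ s ∈ Set.Icc p q, L * (q - s) ≤ w q - w s) :
    ∫ s in p..q, w s ≤ (q - p) * w q - L * (q - p) ^ 2 / 2 := by
  have hc : Continuous fun s => w q - L * (q - s) := by fun_prop
  have h1 : ∫ s in p..q, w s ≤ ∫ s in p..q, (w q - L * (q - s)) :=
    intervalIntegral.integral_mono_on hpq hw.intervalIntegrable (hc.intervalIntegrable _ _)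
      fun s hs => by linarith [hL s hs]
  refine h1.trans_eq ?_
  have hd : ∀ s ∈ Set.uIcc p q,
      HasDerivAt (fun s => w q * s + L * (q - s) ^ 2 / 2) (w q - L * (q - s)) s := by
    intro s _
    have := (((hasDerivAt_id s).const_mul (w q)).add
      (((((hasDerivAt_id s).const_sub q).pow 2).const_mul L).div_const 2))
    refine this.congr_deriv ?_
    simp; ring
  rw [intervalIntegral.integral_eq_sub_of_hasDerivAt hd (hc.intervalIntegrable _ _)]
  ring

theorem integral_sub_midpoint_mul_le_of_lipschitz (hpq : p ≤ q)
    (hw : ContinuousOn w (Set.uIcc p q))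
    (hL : ∀ r ∈ Set.Icc p q, ∀ s ∈ Set.Icc p q, r ≤ s → w s - w r ≤ L * (s - r)) :
    ∫ s in p..q, (s - (p + q) / 2) * w s ≤ L * (q - p) ^ 3 / 12 := by
  rw [← integral_sub_midpoint_mul_sub_const hw (w ((p + q) / 2))]
  have hc : Continuous fun s => L * (s - (p + q) / 2) ^ 2 := by fun_prop
  have hmid : (p + q) / 2 ∈ Set.Icc p q := ⟨by linarith, by linarith⟩
  have h1 : ∫ s in p..q, (s - (p + q) / 2) * (w s - w ((p + q) / 2)) ≤
      ∫ s in p..q, L * (s - (p + q) / 2) ^ 2 := by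
    refine intervalIntegral.integral_mono_on hpq (ContinuousOn.intervalIntegrable (by fun_prop))
      (hc.intervalIntegrable _ _) fun s hs => ?_
    rcases le_total s ((p + q) / 2) with h | h
    · nlinarith [hL s hs _ hmid h]
    · nlinarith [hL _ hmid s hs h]
  refine h1.trans_eq ?_
  have hd : ∀ s ∈ Set.uIcc p q,
      HasDerivAt (fun s => L * (s - (p + q) / 2) ^ 3 / 3) (L * (s - (p + q) / 2) ^ 2) s := by
    intro s _
    have := ((((hasDerivAt_id s).sub_const ((p + q) / 2)).pow 3).const_mul L).div_const 3
    refine this.congr_deriv ?_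
    simp; ring
  rw [intervalIntegral.integral_eq_sub_of_hasDerivAt hd (hc.intervalIntegrable _ _)]
  ring

end Moments

/-! ### The weakly singular kernel -/

section Omega

variable {α σ r s : ℝ}

theorem omega_one_sub (α x : ℝ) : omega (1 - α) x = x ^ (-α) / Real.Gamma (1 - α) := by
  rw [omega]; congr 2; ring

theorem omega_one_sub_nonneg (hα₁ : α < 1) {x : ℝ} (hx : 0 ≤ x) : 0 ≤ omega (1 - α) x :=
  div_nonneg (Real.rpow_nonneg hx _) (Real.Gamma_pos_of_pos (by linarith)).le

theorem omega_one_sub_pos (hα₁ : α < 1) {x : ℝ} (hx : 0 < x) : 0 < omega (1 - α) x :=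
  div_pos (Real.rpow_pos_of_pos hx _) (Real.Gamma_pos_of_pos (by linarith))

theorem omega_one_sub_anti (hα₀ : 0 < α) (hα₁ : α < 1) {x y : ℝ} (hx : 0 < x) (hxy : x ≤ y) :
    omega (1 - α) y ≤ omega (1 - α) x := by
  rw [omega_one_sub, omega_one_sub]
  exact div_le_div_of_nonneg_right
    (Real.rpow_le_rpow_of_nonpos hx hxy (by linarith)) (Real.Gamma_pos_of_pos (by linarith)).le

/-- The slope of `s ↦ ω_{1-α}(σ - s)`. -/
noncomputable def omegaSlope (α σ s : ℝ) : ℝ :=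
  α * (σ - s) ^ (-α - 1) / Real.Gamma (1 - α)

theorem omegaSlope_nonneg (hα₀ : 0 < α) (hα₁ : α < 1) (hs : s < σ) : 0 ≤ omegaSlope α σ s :=
  div_nonneg (mul_nonneg hα₀.le (Real.rpow_nonneg (by linarith) _))
    (Real.Gamma_pos_of_pos (by linarith)).le

theorem omegaSlope_mono (hα₀ : 0 < α) (hα₁ : α < 1) (hrs : r ≤ s) (hs : s < σ) :
    omegaSlope α σ r ≤ omegaSlope α σ s := by
  refine div_le_div_of_nonneg_right (mul_le_mul_of_nonneg_left ?_ hα₀.le)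
    (Real.Gamma_pos_of_pos (by linarith)).le
  exact Real.rpow_le_rpow_of_nonpos (by linarith) (by linarith) (by linarith)

theorem hasDerivAt_omega_sub (hs : s < σ) :
    HasDerivAt (fun s => omega (1 - α) (σ - s)) (omegaSlope α σ s) s := by
  have h := (((hasDerivAt_id s).const_sub σ).rpow_const (p := -α)
    (Or.inl (by simp only [id]; linarith))).div_const (Real.Gamma (1 - α))
  simp only [omega_one_sub]
  refine h.congr_deriv ?_
  simp only [omegaSlope, id]; ring

theorem exists_omega_sub_eq (hrs : r ≤ s) (hs : s < σ) :
    ∃ c ∈ Set.Icc r s, omega (1 - α) (σ - s) - omega (1 - α) (σ - r) =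
      omegaSlope α σ c * (s - r) := by
  rcases hrs.eq_or_lt with rfl | h
  · exact ⟨r, ⟨le_rfl, le_rfl⟩, by simp⟩
  · obtain ⟨c, hc, hc'⟩ := exists_hasDerivAt_eq_slope (fun s => omega (1 - α) (σ - s))
      (omegaSlope α σ) h
      (fun x hx => (hasDerivAt_omega_sub (hx.2.trans_lt hs)).continuousAt.continuousWithinAt)
      (fun x hx => hasDerivAt_omega_sub (hx.2.trans hs))
    refine ⟨c, ⟨hc.1.le, hc.2.le⟩, ?_⟩
    rw [hc', div_mul_cancel₀]
    linarith

theorem continuousOn_omega_sub {p q : ℝ} (hpq : p ≤ q) (hq : q < σ) :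
    ContinuousOn (fun s => omega (1 - α) (σ - s)) (Set.uIcc p q) := fun _ hx =>
  (hasDerivAt_omega_sub
    ((Set.uIcc_of_le hpq ▸ hx).2.trans_lt hq)).continuousAt.continuousWithinAt

theorem monotoneOn_omega_sub (hα₀ : 0 < α) (hα₁ : α < 1) {p q : ℝ} (hq : q < σ) :
    MonotoneOn (fun s => omega (1 - α) (σ - s)) (Set.Icc p q) := fun _ _ y hy hxy =>
  omega_one_sub_anti hα₀ hα₁ (by linarith [hy.2]) (by linarith)

theorem integral_omega_sub (hα₁ : α < 1) (p : ℝ) :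
    ∫ s in p..σ, omega (1 - α) (σ - s) = (σ - p) ^ (1 - α) / Real.Gamma (2 - α) := by
  rw [intervalIntegral.integral_comp_sub_left (fun x => omega (1 - α) x)]
  simp only [omega_one_sub]
  rw [intervalIntegral.integral_div, integral_rpow (Or.inl (by linarith)), sub_self,
    Real.zero_rpow (by linarith), sub_zero, show 2 - α = (1 - α) + 1 by ring,
    Real.Gamma_add_one (by linarith), div_div, show -α + 1 = 1 - α by ring]

theorem intervalIntegrable_omega_sub (hα₁ : α < 1) (p q : ℝ) :
    IntervalIntegrable (fun s => omega (1 - α) (σ - s)) MeasureTheory.volume p q := by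
  simp only [omega_one_sub]
  have h := (intervalIntegral.intervalIntegrable_rpow' (a := σ - p) (b := σ - q)
    (r := -α) (by linarith)).comp_sub_left σ
  simp only [sub_sub_cancel] at h
  exact h.div_const _

end Omega

/-! ### Mesh -/

section Mesh

variable {N : ℕ} {t : ℕ → ℝ}

theorem IsTimeMesh.mono (ht : IsTimeMesh N t) {j k : ℕ} (hjk : j ≤ k) (hk : k ≤ N) :
    t j ≤ t k := by
  induction k, hjk using Nat.le_induction with
  | base => exact le_rfl
  | succ k _ ih => exact (ih (by omega)).trans (ht.2 k (by omega)).le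

theorem IsTimeMesh.step_pos (ht : IsTimeMesh N t) {k : ℕ} (hk : 1 ≤ k) (hkN : k ≤ N) :
    0 < step t k := by
  have h := ht.2 (k - 1) (by omega)
  rw [Nat.sub_add_cancel hk] at h
  exact sub_pos.2 h

theorem IsTimeMesh.nonneg (ht : IsTimeMesh N t) {k : ℕ} (hk : k ≤ N) : 0 ≤ t k :=
  ht.1 ▸ ht.mono (Nat.zero_le k) hk

theorem IsTimeMesh.pos (ht : IsTimeMesh N t) {k : ℕ} (hk : 1 ≤ k) (hkN : k ≤ N) : 0 < t k := by
  have h := ht.step_pos hk hkN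
  have h' := ht.nonneg (k := k - 1) (by omega)
  rw [step] at h
  linarith

theorem offsetTime_sub (θ : ℝ) (t : ℕ → ℝ) (n : ℕ) :
    offsetTime θ t n - t (n - 1) = (1 - θ) * step t n := by
  rw [offsetTime, step]; ring

theorem IsTimeMesh.lt_offsetTime (ht : IsTimeMesh N t) {θ : ℝ} (hθ : θ < 1) {k n : ℕ}
    (hk : k < n) (hn : n ≤ N) : t k < offsetTime θ t n := by
  have h1 := mul_pos (sub_pos.2 hθ) (ht.step_pos (k := n) (by omega) hn)
  rw [← offsetTime_sub] at h1
  have h2 := ht.mono (j := k) (k := n - 1) (by omega) (by omega)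
  linarith

theorem IsTimeMesh.offsetTime_le (ht : IsTimeMesh N t) {θ : ℝ} (hθ : 0 ≤ θ) {n : ℕ}
    (hn : n ≤ N) : offsetTime θ t n ≤ t n := by
  have h := ht.mono (j := n - 1) (k := n) (by omega) hn
  rw [offsetTime]
  nlinarith

theorem IsTimeMesh.step_le (ht : IsTimeMesh N t) {α θ : ℝ} (hM1 : CondM1 α θ N t) {k : ℕ}
    (hk : 1 ≤ k) (hkN : k + 1 ≤ N) : step t k ≤ 7 / 4 * step t (k + 1) :=
  (div_le_iff₀ (ht.step_pos (by omega) hkN)).1 (hM1.2 k hk hkN)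

end Mesh

/-! ### Bounds for the discrete kernels -/

section Kernel

variable {α θ : ℝ} {N : ℕ} {t : ℕ → ℝ} {n m : ℕ}

theorem coeffA_zero (hα₁ : α < 1) (ht : IsTimeMesh N t) (hθ₀ : 0 ≤ θ) (hθ₁ : θ < 1)
    (hn : 1 ≤ n) (hnN : n ≤ N) : (1 - α) * coeffA α θ t n 0 =
      (1 - θ) * omega (1 - α) (offsetTime θ t n - t (n - 1)) := by
  have hτ := ht.step_pos hn hnN
  have hθ' : 0 < 1 - θ := by linarith
  have hG : Real.Gamma (1 - α) ≠ 0 := (Real.Gamma_pos_of_pos (by linarith)).ne'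
  have h1α : 1 - α ≠ 0 := by linarith
  rw [coeffA, Nat.sub_zero, min_eq_right (ht.offsetTime_le hθ₀ hnN), integral_omega_sub hα₁,
    offsetTime_sub, omega_one_sub, show 2 - α = (1 - α) + 1 by ring, Real.Gamma_add_one h1α,
    show 1 - α = -α + 1 by ring, Real.rpow_add_one (mul_pos hθ' hτ).ne',
    show -α + 1 = 1 - α by ring]
  field_simp

/-- The exact factor is `(1 - θ)^(1-α) ≥ 1 - θ ≥ 1/2`; only `4/11` is kept, to match the constant on
the other subintervals. -/
theorem coeffA_zero_ge (hα₀ : 0 < α) (hα₁ : α < 1) (ht : IsTimeMesh N t) (hθ : θ = α / 2)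
    (hn : 1 ≤ n) (hnN : n ≤ N) :
    4 / 11 * (step t n ^ (-α) / Real.Gamma (2 - α)) ≤ coeffA α θ t n 0 := by
  have hτ := ht.step_pos hn hnN
  have hθ' : 0 < 1 - θ := by linarith
  rw [coeffA, Nat.sub_zero, min_eq_right (ht.offsetTime_le (by linarith) hnN),
    integral_omega_sub hα₁, offsetTime_sub, Real.mul_rpow hθ'.le hτ.le]
  have h1 : step t n ^ (1 - α) = step t n ^ (-α) * step t n := by
    rw [← Real.rpow_add_one hτ.ne']; congr 1; ring
  have h2 : (1 / 2 : ℝ) ≤ (1 - θ) ^ (1 - α) := by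
    have h3 : (1 - θ) ^ (1 : ℝ) ≤ (1 - θ) ^ (1 - α) :=
      Real.rpow_le_rpow_of_exponent_ge hθ' (by linarith) (by linarith)
    rw [Real.rpow_one] at h3
    linarith
  have hG : 0 < Real.Gamma (2 - α) := Real.Gamma_pos_of_pos (by linarith)
  rw [h1, show 1 / step t n * ((1 - θ) ^ (1 - α) * (step t n ^ (-α) * step t n) /
    Real.Gamma (2 - α)) = (1 - θ) ^ (1 - α) * (step t n ^ (-α) / Real.Gamma (2 - α)) by
      field_simp]
  exact mul_le_mul_of_nonneg_right (by linarith)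
    (div_nonneg (Real.rpow_nonneg hτ.le _) hG.le)

theorem coeffA_eq (ht : IsTimeMesh N t) (hθ₁ : θ < 1) (hm : 1 ≤ m)
    (hmn : m < n) (hnN : n ≤ N) : coeffA α θ t n m = 1 / step t (n - m) *
      ∫ s in (t (n - m - 1))..(t (n - m)), omega (1 - α) (offsetTime θ t n - s) := by
  rw [coeffA, min_eq_left (ht.lt_offsetTime hθ₁ (by omega) hnN).le]

theorem coeffB_nonneg (hα₀ : 0 < α) (hα₁ : α < 1) (ht : IsTimeMesh N t) (hθ₁ : θ < 1)
    (hm : 1 ≤ m) (hmn : m < n) (hnN : n ≤ N) : 0 ≤ coeffB α θ t n m := by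
  have hp := ht.mono (j := n - m - 1) (k := n - m) (by omega) (by omega)
  have hq := ht.lt_offsetTime hθ₁ (k := n - m) (by omega) hnN
  have h1 := ht.step_pos (k := n - m) (by omega) (by omega)
  have h2 := ht.step_pos (k := n - m + 1) (by omega) (by omega)
  exact mul_nonneg (by positivity) (integral_sub_midpoint_mul_nonneg hp
    (continuousOn_omega_sub hp hq) (monotoneOn_omega_sub hα₀ hα₁ hq))

theorem ratio_mul_coeffB_nonneg (hα₀ : 0 < α) (hα₁ : α < 1) (ht : IsTimeMesh N t)
    (hθ₁ : θ < 1) (hm : 1 ≤ m) (hmn : m < n) (hnN : n ≤ N) :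
    0 ≤ ratio t (n - m) * coeffB α θ t n m :=
  mul_nonneg (div_pos (ht.step_pos (by omega) (by omega))
    (ht.step_pos (by omega) (by omega))).le (coeffB_nonneg hα₀ hα₁ ht hθ₁ hm hmn hnN)

/-- The lower half of the interleaving: `b` is at most `τ_k / (τ_k + τ_{k+1})` times the excess of
the mean `a` over the left endpoint value, hence at most that excess. -/
theorem coeffB_le_sub (hα₀ : 0 < α) (hα₁ : α < 1) (ht : IsTimeMesh N t) (hθ₁ : θ < 1)
    (hm : 1 ≤ m) (hmn : m < n) (hnN : n ≤ N) :
    omega (1 - α) (offsetTime θ t n - t (n - m - 1)) ≤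
      coeffA α θ t n m - coeffB α θ t n m := by
  have hp := ht.mono (j := n - m - 1) (k := n - m) (by omega) (by omega)
  have hq := ht.lt_offsetTime hθ₁ (k := n - m) (by omega) hnN
  have h1 := ht.step_pos (k := n - m) (by omega) (by omega)
  have h2 := ht.step_pos (k := n - m + 1) (by omega) (by omega)
  have h := integral_sub_midpoint_mul_le_of_monotoneOn hp (continuousOn_omega_sub hp hq)
    (monotoneOn_omega_sub hα₀ hα₁ hq)
  have hI : 0 ≤ (∫ s in (t (n - m - 1))..(t (n - m)), omega (1 - α) (offsetTime θ t n - s)) -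
      (t (n - m) - t (n - m - 1)) * omega (1 - α) (offsetTime θ t n - t (n - m - 1)) := by
    have h3 := integral_sub_midpoint_mul_nonneg hp (continuousOn_omega_sub hp hq)
      (monotoneOn_omega_sub hα₀ hα₁ hq)
    have h4 : 0 < (t (n - m) - t (n - m - 1)) / 2 := by rw [step] at h1; linarith
    exact nonneg_of_mul_nonneg_right (h3.trans h) h4
  rw [coeffA_eq ht hθ₁ hm hmn hnN, coeffB]
  change _ ≤ step t (n - m) / 2 * (_ - step t (n - m) * _) at h
  change 0 ≤ _ - step t (n - m) * _ at hI
  set x := step t (n - m)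
  set y := step t (n - m + 1)
  set I := ∫ s in (t (n - m - 1))..(t (n - m)), omega (1 - α) (offsetTime θ t n - s)
  set w := omega (1 - α) (offsetTime θ t n - t (n - m - 1))
  have h5 := mul_le_mul_of_nonneg_left h (show 0 ≤ 2 / (x * (x + y)) by positivity)
  have h6 : 2 / (x * (x + y)) * (x / 2 * (I - x * w)) ≤ 1 / x * (I - x * w) := by
    rw [← mul_assoc]
    refine mul_le_mul_of_nonneg_right ?_ hI
    rw [show 2 / (x * (x + y)) * (x / 2) = 1 / (x + y) by field_simp]
    exact one_div_le_one_div_of_le h1 (by linarith)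
  have h7 : 1 / x * (I - x * w) = 1 / x * I - w := by field_simp
  linarith

/-- The weight `s - t_{k-1/2}` is at most `τ_k / 2`, so `b ≤ τ_k / (τ_k + τ_{k+1}) · a`, and a ratio
of at most `7/4` makes this fraction at most `7/11`. -/
theorem coeffA_le_sub (hα₀ : 0 < α) (hα₁ : α < 1) (ht : IsTimeMesh N t)
    (hM1 : CondM1 α θ N t) (hm : 1 ≤ m) (hmn : m < n) (hnN : n ≤ N) :
    4 / 11 * coeffA α θ t n m ≤ coeffA α θ t n m - coeffB α θ t n m := by
  have hθ₁ : θ < 1 := by linarith [hM1.1]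
  have hp := ht.mono (j := n - m - 1) (k := n - m) (by omega) (by omega)
  have hq := ht.lt_offsetTime hθ₁ (k := n - m) (by omega) hnN
  have h1 := ht.step_pos (k := n - m) (by omega) (by omega)
  have h2 := ht.step_pos (k := n - m + 1) (by omega) (by omega)
  have h3 := ht.step_le hM1 (k := n - m) (by omega) (by omega)
  have hnn : ∀ s ∈ Set.Icc (t (n - m - 1)) (t (n - m)),
      0 ≤ omega (1 - α) (offsetTime θ t n - s) :=
    fun s hs => omega_one_sub_nonneg hα₁ (by linarith [hs.2])
  have h := integral_sub_midpoint_mul_le hp (continuousOn_omega_sub hp hq) hnn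
  have hI := intervalIntegral.integral_nonneg (μ := MeasureTheory.volume) hp hnn
  rw [coeffA_eq ht hθ₁ hm hmn hnN, coeffB]
  change _ ≤ step t (n - m) / 2 * _ at h
  set x := step t (n - m)
  set y := step t (n - m + 1)
  set I := ∫ s in (t (n - m - 1))..(t (n - m)), omega (1 - α) (offsetTime θ t n - s)
  have h5 := mul_le_mul_of_nonneg_left h (show 0 ≤ 2 / (x * (x + y)) by positivity)
  have h6 : 2 / (x * (x + y)) * (x / 2 * I) ≤ 7 / 11 * (1 / x * I) := by
    rw [← mul_assoc, ← mul_assoc]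
    refine mul_le_mul_of_nonneg_right ?_ hI
    rw [show 2 / (x * (x + y)) * (x / 2) = 1 / (x + y) by field_simp,
      div_le_iff₀ (by positivity), mul_one_div, div_mul_eq_mul_div, le_div_iff₀ h1]
    linarith
  linarith

/-- The upper half of the interleaving. By convexity the mean `a` falls short of the right endpoint
value by at least `L τ / 2`, where `L` is the slope at the left endpoint; the correction from the
preceding interval, where slopes are at most `L`, fits into this gap. -/
theorem coeffA_add_ratio_mul_le (hα₀ : 0 < α) (hα₁ : α < 1) (ht : IsTimeMesh N t)
    (hM1 : CondM1 α θ N t) (hm : 1 ≤ m) (hmn : m + 1 < n) (hnN : n ≤ N) :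
    coeffA α θ t n m + ratio t (n - m - 1) * coeffB α θ t n (m + 1) ≤
      omega (1 - α) (offsetTime θ t n - t (n - m)) := by
  have hθ₁ : θ < 1 := by linarith [hM1.1]
  obtain ⟨k, hk⟩ : ∃ k, n - m = k + 2 := ⟨n - m - 2, by omega⟩
  have hk1 : n - (m + 1) = k + 1 := by omega
  have hp0 := ht.mono (j := k) (k := k + 1) (by omega) (by omega)
  have hp := ht.mono (j := k + 1) (k := k + 2) (by omega) (by omega)
  have hq := ht.lt_offsetTime hθ₁ (k := k + 2) (by omega) hnN
  have h1 := ht.step_pos (k := k + 1) (by omega) (by omega)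
  have h2 := ht.step_pos (k := k + 2) (by omega) (by omega)
  have h3 := ht.step_le hM1 (k := k + 1) (by omega) (by omega)
  have hA := integral_le_of_slope_le (L := omegaSlope α (offsetTime θ t n) (t (k + 1))) hp
    (continuousOn_omega_sub (α := α) hp hq) (by
      intro s hs
      obtain ⟨c, hc, hc'⟩ := exists_omega_sub_eq (α := α) hs.2 hq
      rw [hc']
      exact mul_le_mul_of_nonneg_right
        (omegaSlope_mono hα₀ hα₁ (hs.1.trans hc.1) (hc.2.trans_lt hq)) (by linarith [hs.2]))
  have hB := integral_sub_midpoint_mul_le_of_lipschitz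
    (L := omegaSlope α (offsetTime θ t n) (t (k + 1))) hp0
    (continuousOn_omega_sub (α := α) hp0 (hp.trans_lt hq)) (by
      intro r hr s hs hrs
      obtain ⟨c, hc, hc'⟩ := exists_omega_sub_eq (α := α) hrs (hs.2.trans_lt (hp.trans_lt hq))
      rw [hc']
      exact mul_le_mul_of_nonneg_right
        (omegaSlope_mono hα₀ hα₁ (hc.2.trans hs.2) (hp.trans_lt hq)) (by linarith))
  have hL := omegaSlope_nonneg hα₀ hα₁ (hp.trans_lt hq)
  rw [coeffA_eq ht hθ₁ hm (by omega) hnN, coeffB, hk, hk1, ratio]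
  simp only [Nat.add_sub_cancel, show k + 2 - 1 = k + 1 from rfl, show k + 1 + 1 = k + 2 from rfl]
  change _ ≤ step t (k + 2) * _ - _ * step t (k + 2) ^ 2 / 2 at hA
  change _ ≤ _ * step t (k + 1) ^ 3 / 12 at hB
  set x := step t (k + 1)
  set y := step t (k + 2)
  set L := omegaSlope α (offsetTime θ t n) (t (k + 1))
  set w := omega (1 - α) (offsetTime θ t n - t (k + 2))
  set I := ∫ s in (t (k + 1))..(t (k + 2)), omega (1 - α) (offsetTime θ t n - s)
  set J := ∫ s in (t k)..(t (k + 1)), (s - (t k + t (k + 1)) / 2) *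
    omega (1 - α) (offsetTime θ t n - s)
  have h4 : 1 / y * I ≤ w - L * y / 2 := by
    refine (mul_le_mul_of_nonneg_left hA (by positivity)).trans_eq ?_
    field_simp
  have h5 : x / y * (2 / (x * (x + y)) * J) ≤ L * x ^ 3 / (6 * (y * (x + y))) := by
    rw [show x / y * (2 / (x * (x + y)) * J) = 2 / (y * (x + y)) * J by field_simp]
    refine (mul_le_mul_of_nonneg_left hB (by positivity)).trans_eq ?_
    field_simp; ring
  have h6 : L * x ^ 3 / (6 * (y * (x + y))) ≤ L * y / 2 := by
    rw [div_le_iff₀ (by positivity)]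
    -- With `r = x / y` this is `r³ ≤ 3(1 + r)`, which holds for `r ≤ 7/4`.
    have h7 : x ^ 3 ≤ 3 * y ^ 2 * (x + y) := by
      have h8 : x ^ 2 ≤ (7 / 4 * y) ^ 2 := pow_le_pow_left₀ h1.le h3 2
      have h9 := mul_le_mul_of_nonneg_right h8 h1.le
      have h10 : x * y ^ 2 ≤ 7 / 4 * y * y ^ 2 :=
        mul_le_mul_of_nonneg_right h3 (sq_nonneg _)
      have h11 : 0 < y ^ 3 := by positivity
      nlinarith
    have h12 := mul_le_mul_of_nonneg_left h7 hL
    linarith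
  linarith

theorem kernelA_zero_ge (hα₀ : 0 < α) (hα₁ : α < 1) (ht : IsTimeMesh N t) (hθ₁ : θ < 1)
    (hn : 1 ≤ n) (hnN : n ≤ N) : coeffA α θ t n 0 ≤ kernelA α θ t n 0 := by
  rw [kernelA, if_pos (rfl : (0 : ℕ) = 0)]
  split_ifs with h
  · rw [h]
  · have := ratio_mul_coeffB_nonneg hα₀ hα₁ ht hθ₁ (m := 1) le_rfl (by omega) hnN
    linarith

theorem kernelA_ge_sub (hα₀ : 0 < α) (hα₁ : α < 1) (ht : IsTimeMesh N t) (hθ₁ : θ < 1)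
    (hm : 1 ≤ m) (hmn : m < n) (hnN : n ≤ N) :
    coeffA α θ t n m - coeffB α θ t n m ≤ kernelA α θ t n m := by
  rw [kernelA, if_neg (by omega), if_neg (by omega)]
  split_ifs with h
  · rw [h]
  · have := ratio_mul_coeffB_nonneg hα₀ hα₁ ht hθ₁ (m := m + 1) (by omega) (by omega) hnN
    rw [← Nat.sub_sub] at this
    linarith

theorem kernelA_le_omega (hα₀ : 0 < α) (hα₁ : α < 1) (ht : IsTimeMesh N t)
    (hM1 : CondM1 α θ N t) (hm : 1 ≤ m) (hmn : m < n) (hnN : n ≤ N) :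
    kernelA α θ t n m ≤ omega (1 - α) (offsetTime θ t n - t (n - m)) := by
  have hθ₁ : θ < 1 := by linarith [hM1.1]
  have hB := coeffB_nonneg hα₀ hα₁ ht hθ₁ hm hmn hnN
  rw [kernelA, if_neg (by omega), if_neg (by omega)]
  split_ifs with h
  · rw [← h]
    have hp := ht.mono (j := n - m - 1) (k := n - m) (by omega) (by omega)
    have hq := ht.lt_offsetTime hθ₁ (k := n - m) (by omega) hnN
    have h1 := ht.step_pos (k := n - m) (by omega) (by omega)
    -- On the first subinterval there is no preceding correction, so monotonicity alone (slope `0`)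
    -- suffices.
    have hA := integral_le_of_slope_le (L := 0) hp (continuousOn_omega_sub (α := α) hp hq)
      (fun s hs => by
        have := monotoneOn_omega_sub hα₀ hα₁ hq hs (Set.right_mem_Icc.2 hp) hs.2
        simp only at this
        linarith)
    rw [coeffA_eq ht hθ₁ hm hmn hnN]
    change _ ≤ step t (n - m) * _ - _ at hA
    have h2 := mul_le_mul_of_nonneg_left hA (one_div_pos.2 h1).le
    rw [zero_mul, zero_div, sub_zero, ← mul_assoc, one_div_mul_cancel h1.ne', one_mul] at h2
    linarith
  · linarith [coeffA_add_ratio_mul_le hα₀ hα₁ ht hM1 hm (by omega) hnN]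

/-- For `θ = α/2` one has `1 - 2θ = 1 - α`, and `(1 - α) a_0` equals `(1 - θ)` times the very value
`ω_{1-α}(t_{n-θ} - t_{n-1})` that bounds `A_1` from above. -/
theorem kernelA_one_le (hα₀ : 0 < α) (hα₁ : α < 1) (ht : IsTimeMesh N t)
    (hM1 : CondM1 α θ N t) (hn : 1 < n) (hnN : n ≤ N) :
    (1 - θ) * kernelA α θ t n 1 ≤ (1 - 2 * θ) * kernelA α θ t n 0 := by
  have hθ := hM1.1
  have h1 := kernelA_le_omega hα₀ hα₁ ht hM1 le_rfl hn hnN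
  have h2 := kernelA_zero_ge hα₀ hα₁ ht (θ := θ) (by linarith) hn.le hnN
  have h3 := coeffA_zero hα₁ ht (θ := θ) (by linarith) (by linarith) hn.le hnN
  have h4 := mul_le_mul_of_nonneg_left h1 (show 0 ≤ 1 - θ by linarith)
  have h5 := mul_le_mul_of_nonneg_left h2 (show 0 ≤ 1 - α by linarith)
  rw [show 1 - 2 * θ = 1 - α by rw [hθ]; ring]
  linarith

theorem kernelA_pos (hα₀ : 0 < α) (hα₁ : α < 1) (ht : IsTimeMesh N t)
    (hM1 : CondM1 α θ N t) (hmn : m < n) (hnN : n ≤ N) : 0 < kernelA α θ t n m := by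
  have hθ := hM1.1
  rcases Nat.eq_zero_or_pos m with rfl | hm
  · refine lt_of_lt_of_le ?_ (kernelA_zero_ge hα₀ hα₁ ht (by linarith) hmn hnN)
    refine lt_of_lt_of_le ?_ (coeffA_zero_ge hα₀ hα₁ ht hθ hmn hnN)
    have h1 := Real.rpow_pos_of_pos (ht.step_pos hmn hnN) (-α)
    have h2 : 0 < Real.Gamma (2 - α) := Real.Gamma_pos_of_pos (by linarith)
    positivity
  · refine lt_of_lt_of_le ?_ ((coeffB_le_sub hα₀ hα₁ ht (by linarith) hm hmn hnN).trans
      (kernelA_ge_sub hα₀ hα₁ ht (by linarith) hm hmn hnN))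
    exact omega_one_sub_pos hα₁
      (sub_pos.2 (ht.lt_offsetTime (by linarith) (by omega) hnN))

theorem kernelA_anti (hα₀ : 0 < α) (hα₁ : α < 1) (ht : IsTimeMesh N t)
    (hM1 : CondM1 α θ N t) (hnN : n ≤ N) (hmn : m + 1 < n) :
    kernelA α θ t n (m + 1) ≤ kernelA α θ t n m := by
  have hθ := hM1.1
  rcases Nat.eq_zero_or_pos m with rfl | hm
  · have h1 := kernelA_one_le hα₀ hα₁ ht hM1 hmn hnN
    have h2 := kernelA_pos hα₀ hα₁ ht hM1 (m := 0) (by omega) hnN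
    have h3 : (1 - θ) * kernelA α θ t n 1 ≤ (1 - θ) * kernelA α θ t n 0 := by nlinarith
    exact le_of_mul_le_mul_left h3 (by linarith)
  · have h1 := kernelA_le_omega hα₀ hα₁ ht hM1 (m := m + 1) (by omega) hmn hnN
    have h2 := coeffB_le_sub hα₀ hα₁ ht (θ := θ) (by linarith) hm (by omega : m < n) hnN
    have h3 := kernelA_ge_sub hα₀ hα₁ ht (θ := θ) (by linarith) hm (by omega : m < n) hnN
    rw [← Nat.sub_sub] at h1
    linarith

/-- The kernels dominate the interval means of the exact kernel, up to the factor `4/11`. -/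
theorem integral_omega_le_kernelA (hα₀ : 0 < α) (hα₁ : α < 1) (ht : IsTimeMesh N t)
    (hM1 : CondM1 α θ N t) {k : ℕ} (hk : 1 ≤ k) (hkn : k ≤ n) (hnN : n ≤ N) :
    ∫ s in (t (k - 1))..(t k), omega (1 - α) (t n - s) ≤
      11 / 4 * step t k * kernelA α θ t n (n - k) := by
  have hθ := hM1.1
  have hτ := ht.step_pos hk (hkn.trans hnN)
  rcases hkn.eq_or_lt with rfl | hlt
  · have h1 := (coeffA_zero_ge hα₀ hα₁ ht hθ hk hnN).trans
      (kernelA_zero_ge hα₀ hα₁ ht (by linarith) hk hnN)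
    rw [Nat.sub_self, integral_omega_sub hα₁]
    change step t k ^ (1 - α) / _ ≤ _
    have h2 := mul_le_mul_of_nonneg_left h1 (show 0 ≤ 11 / 4 * step t k by positivity)
    refine le_trans (le_of_eq ?_) h2
    rw [show 1 - α = -α + 1 by ring, Real.rpow_add_one hτ.ne']
    ring
  · have hp := ht.mono (j := k - 1) (k := k) (by omega) (by omega)
    have hq := ht.lt_offsetTime (θ := θ) (by linarith) hlt hnN
    have h1 := (coeffA_le_sub hα₀ hα₁ ht hM1 (m := n - k) (by omega) (by omega) hnN).trans
      (kernelA_ge_sub hα₀ hα₁ ht (by linarith) (by omega) (by omega) hnN)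
    rw [coeffA_eq ht (by linarith) (by omega) (by omega) hnN,
      show n - (n - k) = k by omega] at h1
    have h2 : ∫ s in (t (k - 1))..(t k), omega (1 - α) (t n - s) ≤
        ∫ s in (t (k - 1))..(t k), omega (1 - α) (offsetTime θ t n - s) := by
      refine intervalIntegral.integral_mono_on hp (intervalIntegrable_omega_sub hα₁ _ _)
        (intervalIntegrable_omega_sub hα₁ _ _) fun s hs => ?_
      exact omega_one_sub_anti hα₀ hα₁ (by linarith [hs.2])
        (by linarith [ht.offsetTime_le (θ := θ) (by linarith) hnN])
    have h3 := mul_le_mul_of_nonneg_left h1 (show 0 ≤ 11 / 4 * step t k by positivity)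
    refine h2.trans (le_trans (le_of_eq ?_) h3)
    field_simp

end Kernel

/-! ### Fractional integration of power functions -/

theorem integral_rpow_mul_sub_rpow {u v a : ℝ} (hu : 0 < u) (hv : 0 < v) (ha : 0 < a) :
    ∫ s in (0 : ℝ)..a, s ^ (u - 1) * (a - s) ^ (v - 1) =
      a ^ (u + v - 1) * (Real.Gamma u * Real.Gamma v / Real.Gamma (u + v)) := by
  apply Complex.ofReal_injective
  have h := Complex.betaIntegral_scaled (u : ℂ) (v : ℂ) ha
  rw [Complex.betaIntegral_eq_Gamma_mul_div _ _ (by simpa) (by simpa)] at h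
  rw [← intervalIntegral.integral_ofReal]
  push_cast
  rw [Complex.ofReal_cpow ha.le, ← Complex.Gamma_ofReal, ← Complex.Gamma_ofReal,
    ← Complex.Gamma_ofReal]
  push_cast
  rw [← h]
  refine intervalIntegral.integral_congr fun s hs => ?_
  rw [Set.uIcc_of_le ha.le] at hs
  rw [Complex.ofReal_cpow hs.1, Complex.ofReal_cpow (by linarith [hs.2])]
  push_cast
  rfl

/-- The function `ω_{1+kα}`. -/
noncomputable def powTerm (α : ℝ) (k : ℕ) (x : ℝ) : ℝ := x ^ (k * α) / Real.Gamma (1 + k * α)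

theorem Gamma_one_add_pos {α : ℝ} (hα₀ : 0 < α) (k : ℕ) : 0 < Real.Gamma (1 + k * α) :=
  Real.Gamma_pos_of_pos (by positivity)

theorem powTerm_nonneg {α : ℝ} (hα₀ : 0 < α) (k : ℕ) {x : ℝ} (hx : 0 ≤ x) :
    0 ≤ powTerm α k x :=
  div_nonneg (Real.rpow_nonneg hx _) (Gamma_one_add_pos hα₀ k).le

theorem powTerm_mono {α : ℝ} (hα₀ : 0 < α) (k : ℕ) {x y : ℝ} (hx : 0 ≤ x) (hxy : x ≤ y) :
    powTerm α k x ≤ powTerm α k y :=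
  div_le_div_of_nonneg_right (Real.rpow_le_rpow hx hxy (by positivity))
    (Gamma_one_add_pos hα₀ k).le

theorem powTerm_succ_zero {α : ℝ} (hα₀ : 0 < α) (k : ℕ) : powTerm α (k + 1) 0 = 0 := by
  rw [powTerm, Real.zero_rpow (by positivity), zero_div]

section Fractional

variable {α : ℝ} {k : ℕ}

theorem integral_omega_mul_omega (hα₀ : 0 < α) (hα₁ : α < 1) (k : ℕ) {T : ℝ} (hT : 0 < T) :
    ∫ s in (0 : ℝ)..T, omega (1 - α) (T - s) * omega ((k + 1 : ℕ) * α) s = powTerm α k T := by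
  have hx : 0 < ((k + 1 : ℕ) : ℝ) * α := by positivity
  have h := integral_rpow_mul_sub_rpow hx (show 0 < 1 - α by linarith) hT
  have hG1 := Real.Gamma_pos_of_pos hx
  have hG2 := Real.Gamma_pos_of_pos (show 0 < 1 - α by linarith)
  have e : (fun s => omega (1 - α) (T - s) * omega ((k + 1 : ℕ) * α) s) = fun s =>
      (s ^ (((k + 1 : ℕ) : ℝ) * α - 1) * (T - s) ^ (1 - α - 1)) *
        (1 / (Real.Gamma (((k + 1 : ℕ) : ℝ) * α) * Real.Gamma (1 - α))) := by
    ext s; simp only [omega]; field_simp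
  rw [e, intervalIntegral.integral_mul_const, h, powTerm]
  have e2 : ((k + 1 : ℕ) : ℝ) * α + (1 - α) = 1 + k * α := by push_cast; ring
  rw [e2, show 1 + (k : ℝ) * α - 1 = k * α by ring]
  have := Gamma_one_add_pos hα₀ k
  field_simp

theorem intervalIntegrable_omega_mul_omega (hα₀ : 0 < α) (hα₁ : α < 1) (k : ℕ) {T : ℝ}
    (hT : 0 < T) : IntervalIntegrable
      (fun s => omega (1 - α) (T - s) * omega ((k + 1 : ℕ) * α) s) MeasureTheory.volume 0 T := by
  -- A non-integrable function has integral `0` by convention, so the nonzero Beta integral proves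
  -- integrability.
  refine intervalIntegral.intervalIntegrable_of_integral_ne_zero ?_
  rw [integral_omega_mul_omega hα₀ hα₁ k hT]
  exact (div_pos (Real.rpow_pos_of_pos hT _) (Gamma_one_add_pos hα₀ k)).ne'

theorem intervalIntegrable_omega (hα₀ : 0 < α) (k : ℕ) (p q : ℝ) :
    IntervalIntegrable (omega ((k + 1 : ℕ) * α)) MeasureTheory.volume p q := by
  have hx : 0 < ((k + 1 : ℕ) : ℝ) * α := by positivity
  exact (intervalIntegral.intervalIntegrable_rpow' (by linarith)).div_const _

theorem integral_omega (hα₀ : 0 < α) (k : ℕ) (p q : ℝ) :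
    ∫ s in p..q, omega ((k + 1 : ℕ) * α) s = powTerm α (k + 1) q - powTerm α (k + 1) p := by
  have hx : 0 < ((k + 1 : ℕ) : ℝ) * α := by positivity
  simp only [omega]
  rw [intervalIntegral.integral_div, integral_rpow (Or.inl (by linarith)), powTerm, powTerm,
    add_comm 1, Real.Gamma_add_one hx.ne', sub_add_cancel]
  have := Real.Gamma_pos_of_pos hx
  field_simp

theorem omega_nonneg {β s : ℝ} (hβ : 0 < β) (hs : 0 ≤ s) : 0 ≤ omega β s :=
  div_nonneg (Real.rpow_nonneg hs _) (Real.Gamma_pos_of_pos hβ).le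

theorem omega_anti {β r s : ℝ} (hβ : 0 < β) (hβ₁ : β ≤ 1) (hr : 0 < r) (hrs : r ≤ s) :
    omega β s ≤ omega β r :=
  div_le_div_of_nonneg_right (Real.rpow_le_rpow_of_nonpos hr hrs (by linarith))
    (Real.Gamma_pos_of_pos hβ).le

theorem omega_mono {β r s : ℝ} (hβ₁ : 1 ≤ β) (hr : 0 ≤ r) (hrs : r ≤ s) :
    omega β r ≤ omega β s :=
  div_le_div_of_nonneg_right (Real.rpow_le_rpow hr hrs (by linarith))
    (Real.Gamma_pos_of_pos (by linarith)).le

/-- The mean value point is interior, which keeps it away from the singularities at `0` and `T` in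
Chebyshev's inequality. -/
theorem exists_omega_eq_slope (hα₀ : 0 < α) (k : ℕ) {p q : ℝ} (hp : 0 ≤ p) (hpq : p < q) :
    ∃ c ∈ Set.Ioo p q, omega ((k + 1 : ℕ) * α) c * (q - p) =
      powTerm α (k + 1) q - powTerm α (k + 1) p := by
  have hx : 0 < ((k + 1 : ℕ) : ℝ) * α := by positivity
  obtain ⟨c, hc, hc'⟩ := exists_hasDerivAt_eq_slope (powTerm α (k + 1))
    (omega ((k + 1 : ℕ) * α)) hpq
    ((Real.continuous_rpow_const hx.le).div_const _).continuousOn (fun s hs => by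
      have hs0 : s ≠ 0 := (hp.trans_lt hs.1).ne'
      refine ((Real.hasDerivAt_rpow_const (Or.inl hs0)).div_const _).congr_deriv ?_
      rw [omega, add_comm 1, Real.Gamma_add_one hx.ne']
      have := Real.Gamma_pos_of_pos hx
      field_simp)
  refine ⟨c, hc, ?_⟩
  rw [hc', div_mul_cancel₀]
  linarith

/-- Chebyshev's inequality for the increasing kernel and a decreasing power. -/
theorem integral_omega_mul_omega_le_of_le_one (hα₀ : 0 < α) (hα₁ : α < 1)
    (hk : ((k + 1 : ℕ) : ℝ) * α ≤ 1) {p q T : ℝ} (hp : 0 ≤ p) (hpq : p < q) (hq : q ≤ T) :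
    (∫ s in p..q, omega (1 - α) (T - s) * omega ((k + 1 : ℕ) * α) s) * (q - p) ≤
      (∫ s in p..q, omega (1 - α) (T - s)) *
        (powTerm α (k + 1) q - powTerm α (k + 1) p) := by
  have hx : 0 < ((k + 1 : ℕ) : ℝ) * α := by positivity
  obtain ⟨c, hc, hc'⟩ := exists_omega_eq_slope hα₀ k hp hpq
  have hcp := hc.1
  have hcq := hc.2
  set ψ := omega ((k + 1 : ℕ) * α) with hψ
  set wc := omega (1 - α) (T - c)
  have hi1 : IntervalIntegrable (fun s => wc * ψ s) MeasureTheory.volume p q :=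
    (intervalIntegrable_omega hα₀ k p q).const_mul _
  have hi2 : IntervalIntegrable (fun s => ψ c * omega (1 - α) (T - s)) MeasureTheory.volume p q :=
    (intervalIntegrable_omega_sub hα₁ p q).const_mul _
  have hi3 : IntervalIntegrable (fun _ => wc * ψ c) MeasureTheory.volume p q :=
    intervalIntegrable_const
  have hi0 : IntervalIntegrable (fun s => omega (1 - α) (T - s) * ψ s)
      MeasureTheory.volume p q := by
    refine (intervalIntegrable_omega_mul_omega hα₀ hα₁ k (by linarith)).mono_set ?_
    rw [Set.uIcc_of_le hpq.le, Set.uIcc_of_le (by linarith)]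
    exact Set.Icc_subset_Icc hp hq
  -- This integrates `(ω_{1-α}(T - s) - wc)(ψ s - ψ c) ≤ 0`. Since `ψ c` is the mean of `ψ`, the two
  -- terms with `wc` cancel.
  have h1 : ∫ s in p..q, omega (1 - α) (T - s) * ψ s ≤
      ∫ s in p..q, (wc * ψ s + ψ c * omega (1 - α) (T - s) - wc * ψ c) := by
    refine intervalIntegral.integral_mono_on_of_le_Ioo hpq.le hi0 ((hi1.add hi2).sub hi3)
      fun s hs => ?_
    have hsp := hs.1
    have hsq := hs.2
    rcases le_total s c with h | h
    · have a1 := omega_anti hx hk (by linarith : 0 < s) h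
      have a2 : omega (1 - α) (T - s) ≤ wc := omega_one_sub_anti hα₀ hα₁ (by linarith) (by linarith)
      nlinarith
    · have a1 := omega_anti hx hk (by linarith : 0 < c) h
      have a2 : wc ≤ omega (1 - α) (T - s) := omega_one_sub_anti hα₀ hα₁ (by linarith) (by linarith)
      nlinarith
  rw [intervalIntegral.integral_sub (hi1.add hi2) hi3, intervalIntegral.integral_add hi1 hi2,
    intervalIntegral.integral_const_mul, intervalIntegral.integral_const_mul,
    intervalIntegral.integral_const, hψ, integral_omega hα₀, ← hψ, ← hc', smul_eq_mul] at h1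
  rw [← hc']
  have h2 := mul_le_mul_of_nonneg_right h1 (show 0 ≤ q - p by linarith)
  linarith

theorem integral_omega_mul_omega_le_of_one_le (hα₀ : 0 < α) (hα₁ : α < 1)
    (hk : 1 ≤ ((k + 1 : ℕ) : ℝ) * α) {p q T : ℝ} (hp : 0 ≤ p) (hpq : p < q) (hq : q ≤ T) :
    ∫ s in p..q, omega (1 - α) (T - s) * omega ((k + 1 : ℕ) * α) s ≤
      (∫ s in p..q, omega (1 - α) (T - s)) * omega ((k + 1 : ℕ) * α) q := by
  rw [← intervalIntegral.integral_mul_const]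
  refine intervalIntegral.integral_mono_on hpq.le ?_
    ((intervalIntegrable_omega_sub hα₁ p q).mul_const _) fun s hs => ?_
  · refine (intervalIntegrable_omega_mul_omega hα₀ hα₁ k (by linarith)).mono_set ?_
    rw [Set.uIcc_of_le hpq.le, Set.uIcc_of_le (by linarith)]
    exact Set.Icc_subset_Icc hp hq
  · exact mul_le_mul_of_nonneg_left (omega_mono hk (hp.trans hs.1) hs.2)
      (omega_one_sub_nonneg hα₁ (by linarith [hs.2]))

end Fractional

/-! ### Moments of the complementary kernels -/

/-- Apply the inversion identity to `D` with its `n`-th entry set to `0`, then drop the nonnegative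
term `j = n`. -/
theorem sum_Icc_pred_kernelP_mul_sum_le {A : ℕ → ℕ → ℝ} {n : ℕ} (hn : 1 ≤ n)
    (hpos : ∀ j m, j ≤ n → m < j → 0 < A j m)
    (hanti : ∀ j m, j ≤ n → m + 1 < j → A j (m + 1) ≤ A j m) {D : ℕ → ℝ}
    (hD : ∀ i, 1 ≤ i → i < n → 0 ≤ D i) :
    ∑ j ∈ Icc 1 (n - 1), kernelP A n (n - j) * ∑ i ∈ Icc 1 j, A j (j - i) * D i ≤
      ∑ i ∈ Icc 1 (n - 1), D i := by
  obtain ⟨l, rfl⟩ : ∃ l, n = l + 1 := ⟨n - 1, by omega⟩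
  rw [Nat.add_sub_cancel]
  have h0 := sum_kernelP_mul_sum (n := l + 1) (fun j h1 h2 => (hpos j 0 h2 h1).ne')
    (fun i => if i < l + 1 then D i else 0)
  have h1 : ∑ i ∈ Icc 1 l, (if i < l + 1 then D i else 0) = ∑ i ∈ Icc 1 l, D i :=
    sum_congr rfl fun i hi => if_pos (by have := mem_Icc.1 hi; omega)
  have h4 : ∑ i ∈ Icc 1 (l + 1), (if i < l + 1 then D i else 0) = ∑ i ∈ Icc 1 l, D i := by
    rw [sum_Icc_succ_top (by omega), h1, if_neg (lt_irrefl _), add_zero]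
  have h2 : ∑ j ∈ Icc 1 l, kernelP A (l + 1) (l + 1 - j) *
      ∑ i ∈ Icc 1 j, A j (j - i) * (if i < l + 1 then D i else 0) =
      ∑ j ∈ Icc 1 l, kernelP A (l + 1) (l + 1 - j) * ∑ i ∈ Icc 1 j, A j (j - i) * D i := by
    refine sum_congr rfl fun j hj => ?_
    congr 1
    refine sum_congr rfl fun i hi => ?_
    have := mem_Icc.1 hj
    have := mem_Icc.1 hi
    rw [if_pos (by omega)]
  have h3 : 0 ≤ kernelP A (l + 1) (l + 1 - (l + 1)) *
      ∑ i ∈ Icc 1 (l + 1), A (l + 1) (l + 1 - i) * (if i < l + 1 then D i else 0) := by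
    refine mul_nonneg (kernelP_nonneg (fun j h1 h2 => hpos j 0 h2 h1) hanti _ (by omega))
      (sum_nonneg fun i hi => ?_)
    have hi' := mem_Icc.1 hi
    refine mul_nonneg (hpos _ _ le_rfl (by omega)).le ?_
    split_ifs with h
    · exact hD i hi'.1 h
    · exact le_rfl
  rw [sum_Icc_succ_top (by omega), h2, h4] at h0
  linarith

section KernelMoments

variable {α θ : ℝ} {N : ℕ} {t : ℕ → ℝ} {n : ℕ}

theorem kernelP_kernelA_nonneg (hα₀ : 0 < α) (hα₁ : α < 1) (ht : IsTimeMesh N t)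
    (hM1 : CondM1 α θ N t) (hnN : n ≤ N) {m : ℕ} (hm : m < n) :
    0 ≤ kernelP (kernelA α θ t) n m :=
  kernelP_nonneg (fun _ h1 h2 => kernelA_pos hα₀ hα₁ ht hM1 h1 (h2.trans hnN))
    (fun _ _ h1 h2 => kernelA_anti hα₀ hα₁ ht hM1 (h1.trans hnN) h2) m hm

/-- `powTerm α k` is the convolution of `ω_{1-α}` with `ω_{(k+1)α}`. Splitting it over the mesh
reduces the moment bound to an estimate by `A` on each subinterval, which `P` then inverts. -/
theorem sum_kernelP_mul_powTerm_le_of_step (hα₀ : 0 < α) (hα₁ : α < 1) (ht : IsTimeMesh N t)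
    (hM1 : CondM1 α θ N t) (hn : 1 ≤ n) (hnN : n ≤ N) (k : ℕ) {D : ℕ → ℝ}
    (hD : ∀ i, 1 ≤ i → i < n → 0 ≤ D i)
    (hint : ∀ i j, 1 ≤ i → i ≤ j → j < n →
      ∫ s in (t (i - 1))..(t i), omega (1 - α) (t j - s) * omega ((k + 1 : ℕ) * α) s ≤
        11 / 4 * (kernelA α θ t j (j - i) * D i)) :
    ∑ j ∈ Icc 1 (n - 1), kernelP (kernelA α θ t) n (n - j) * powTerm α k (t j) ≤
      11 / 4 * ∑ i ∈ Icc 1 (n - 1), D i := by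
  have h1 := sum_Icc_pred_kernelP_mul_sum_le hn
    (fun j m h1 h2 => kernelA_pos hα₀ hα₁ ht hM1 h2 (h1.trans hnN))
    (fun j m h1 h2 => kernelA_anti hα₀ hα₁ ht hM1 (h1.trans hnN) h2) hD
  refine le_trans ?_ (mul_le_mul_of_nonneg_left h1 (by norm_num : (0 : ℝ) ≤ 11 / 4))
  rw [mul_sum]
  refine sum_le_sum fun j hj => ?_
  have hj' := mem_Icc.1 hj
  rw [mul_left_comm]
  refine mul_le_mul_of_nonneg_left ?_
    (kernelP_kernelA_nonneg hα₀ hα₁ ht hM1 hnN (by omega))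
  have hT := ht.pos hj'.1 (by omega : j ≤ N)
  rw [← integral_omega_mul_omega hα₀ hα₁ k hT, mul_sum]
  have hsplit := intervalIntegral.sum_integral_adjacent_intervals (a := t) (n := j)
    (μ := MeasureTheory.volume)
    (f := fun s => omega (1 - α) (t j - s) * omega ((k + 1 : ℕ) * α) s) (fun i hi => by
      refine (intervalIntegrable_omega_mul_omega hα₀ hα₁ k hT).mono_set ?_
      rw [Set.uIcc_of_le (ht.mono (Nat.le_succ i) (by omega)), Set.uIcc_of_le hT.le]
      exact Set.Icc_subset_Icc (ht.nonneg (by omega)) (ht.mono (by omega) (by omega)))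
  rw [ht.1] at hsplit
  rw [← hsplit, sum_Icc_one_eq_sum_range, ← sum_range_reflect]
  refine sum_le_sum fun m hm => ?_
  have hm' := mem_range.1 hm
  have h2 := hint (j - m) j (by omega) (by omega) (by omega)
  rw [show j - 1 - m = j - m - 1 by omega, show j - m - 1 + 1 = j - m by omega]
  exact h2

/-- When `ω_{(k+1)α}` decreases, Chebyshev's inequality gives increments of `V`. When it increases,
right endpoint values are used, and moving them to the next interval costs the mesh ratio: `77/16 =
11/4 · 7/4`. -/
theorem sum_kernelP_mul_powTerm_le (hα₀ : 0 < α) (hα₁ : α < 1) (ht : IsTimeMesh N t)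
    (hM1 : CondM1 α θ N t) (hn : 1 ≤ n) (hnN : n ≤ N) (k : ℕ) :
    ∑ j ∈ Icc 1 (n - 1), kernelP (kernelA α θ t) n (n - j) * powTerm α k (t j) ≤
      77 / 16 * powTerm α (k + 1) (t n) := by
  have hx : 0 < ((k + 1 : ℕ) : ℝ) * α := by positivity
  set V := powTerm α (k + 1) with hV
  have hV0 : 0 ≤ V (t n) := powTerm_nonneg hα₀ _ (ht.nonneg hnN)
  have htel : ∀ l, ∑ i ∈ Icc 1 l, (V (t i) - V (t (i - 1))) = V (t l) - V (t 0) := by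
    intro l
    induction l with
    | zero => simp
    | succ l ih => rw [sum_Icc_succ_top (by omega), ih]; simp
  rcases le_total (((k + 1 : ℕ) : ℝ) * α) 1 with hk | hk
  · have h := sum_kernelP_mul_powTerm_le_of_step hα₀ hα₁ ht hM1 hn hnN k
      (D := fun i => V (t i) - V (t (i - 1)))
      (fun i h1 h2 => sub_nonneg.2 (powTerm_mono hα₀ _ (ht.nonneg (by omega))
        (ht.mono (by omega) (by omega)))) (by
      intro i j hi hij hj
      have hτ := ht.step_pos hi (by omega : i ≤ N)
      have hlt : t (i - 1) < t i := sub_pos.1 hτ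
      have h1 := integral_omega_mul_omega_le_of_le_one hα₀ hα₁ hk
        (ht.nonneg (k := i - 1) (by omega)) hlt (ht.mono hij (by omega))
      have h2 := integral_omega_le_kernelA hα₀ hα₁ ht hM1 hi hij (by omega)
      have h3 : 0 ≤ V (t i) - V (t (i - 1)) :=
        sub_nonneg.2 (powTerm_mono hα₀ _ (ht.nonneg (by omega)) hlt.le)
      change _ * step t i ≤ _ * (V (t i) - V (t (i - 1))) at h1
      have h4 := h1.trans (mul_le_mul_of_nonneg_right h2 h3)
      refine le_of_mul_le_mul_right (h4.trans_eq ?_) hτ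
      ring)
    rw [htel, ht.1, hV, powTerm_succ_zero hα₀, sub_zero, ← hV] at h
    have h5 : V (t (n - 1)) ≤ V (t n) :=
      powTerm_mono hα₀ _ (ht.nonneg (by omega)) (ht.mono (by omega) hnN)
    linarith
  · have h := sum_kernelP_mul_powTerm_le_of_step hα₀ hα₁ ht hM1 hn hnN k
      (D := fun i => step t i * omega ((k + 1 : ℕ) * α) (t i))
      (fun i h1 h2 => mul_nonneg (ht.step_pos h1 (by omega)).le
        (omega_nonneg hx (ht.nonneg (by omega)))) (by
      intro i j hi hij hj
      have hlt : t (i - 1) < t i := sub_pos.1 (ht.step_pos hi (by omega : i ≤ N))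
      have h1 := integral_omega_mul_omega_le_of_one_le hα₀ hα₁ hk
        (ht.nonneg (k := i - 1) (by omega)) hlt (ht.mono hij (by omega))
      have h2 := integral_omega_le_kernelA hα₀ hα₁ ht hM1 hi hij (by omega)
      refine (h1.trans (mul_le_mul_of_nonneg_right h2
        (omega_nonneg hx (ht.nonneg (k := i) (by omega))))).trans_eq ?_
      ring)
    -- The value at `t i` is the left endpoint value on the next interval, which exists because the
    -- sum stops at `n - 1`.
    have h1 : ∑ i ∈ Icc 1 (n - 1), step t i * omega ((k + 1 : ℕ) * α) (t i) ≤
        7 / 4 * ∑ i ∈ Icc 1 (n - 1), (V (t (i + 1)) - V (t i)) := by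
      rw [mul_sum]
      refine sum_le_sum fun i hi => ?_
      have hi' := mem_Icc.1 hi
      have hle := ht.mono (j := i) (k := i + 1) (by omega) (by omega)
      have h2 : ∫ s in (t i)..(t (i + 1)), omega ((k + 1 : ℕ) * α) (t i) ≤
          ∫ s in (t i)..(t (i + 1)), omega ((k + 1 : ℕ) * α) s :=
        intervalIntegral.integral_mono_on hle intervalIntegrable_const
          (intervalIntegrable_omega hα₀ k _ _)
          fun s hs => omega_mono hk (ht.nonneg (by omega)) hs.1
      rw [integral_omega hα₀, intervalIntegral.integral_const, smul_eq_mul] at h2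
      have h3 := mul_le_mul_of_nonneg_right (ht.step_le hM1 hi'.1 (by omega))
        (omega_nonneg hx (ht.nonneg (k := i) (by omega)))
      change step t (i + 1) * _ ≤ _ at h2
      linarith
    have h2 : ∑ i ∈ Icc 1 (n - 1), (V (t (i + 1)) - V (t i)) ≤ V (t n) := by
      have h3 := htel n
      obtain ⟨l, rfl⟩ : ∃ l, n = l + 1 := ⟨n - 1, by omega⟩
      have h4 : ∑ i ∈ Icc 1 l, (V (t (i + 1)) - V (t i)) = V (t (l + 1)) - V (t 1) := by
        clear * -
        induction l with
        | zero => simp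
        | succ l ih => rw [sum_Icc_succ_top (by omega), ih]; simp
      rw [Nat.add_sub_cancel, h4]
      have : 0 ≤ V (t 1) := powTerm_nonneg hα₀ _ (ht.nonneg (by omega))
      linarith
    linarith

/-- `ω_{1-α}(t j)` is at most its mean over the first subinterval, hence at most `11/4 · A j (j -
1)`, and `∑ P · A` is `1`. -/
theorem sum_kernelP_mul_omega_le (hα₀ : 0 < α) (hα₁ : α < 1) (ht : IsTimeMesh N t)
    (hM1 : CondM1 α θ N t) (hn : 1 ≤ n) (hnN : n ≤ N) :
    ∑ j ∈ Icc 1 n, kernelP (kernelA α θ t) n (n - j) * omega (1 - α) (t j) ≤ 11 / 4 := by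
  have h1 := sum_Icc_kernelP_mul (A := kernelA α θ t) (n := n)
    (fun j h1 h2 => (kernelA_pos hα₀ hα₁ ht hM1 h1 (h2.trans hnN)).ne') 1 le_rfl hn
  suffices h : _ ≤ 11 / 4 * ∑ j ∈ Icc 1 n,
      kernelP (kernelA α θ t) n (n - j) * kernelA α θ t j (j - 1) by rwa [h1, mul_one] at h
  rw [mul_sum]
  refine sum_le_sum fun j hj => ?_
  have hj' := mem_Icc.1 hj
  rw [mul_left_comm]
  refine mul_le_mul_of_nonneg_left ?_ (kernelP_kernelA_nonneg hα₀ hα₁ ht hM1 hnN (by omega))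
  have h2 := integral_omega_le_kernelA hα₀ hα₁ ht hM1 le_rfl hj'.1 (hj'.2.trans hnN)
  have hτ := ht.step_pos (k := 1) le_rfl (by omega)
  have ht1 := ht.mono hj'.1 (hj'.2.trans hnN)
  have h3 : ∫ s in (t (1 - 1))..(t 1), omega (1 - α) (t j) ≤
      ∫ s in (t (1 - 1))..(t 1), omega (1 - α) (t j - s) := by
    refine intervalIntegral.integral_mono_on_of_le_Ioo (sub_pos.1 hτ).le
      intervalIntegrable_const (intervalIntegrable_omega_sub hα₁ _ _) fun s hs => ?_
    have hs1 := hs.1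
    rw [Nat.sub_self, ht.1] at hs1
    exact omega_one_sub_anti hα₀ hα₁ (by linarith [hs.2]) (by linarith)
  rw [intervalIntegral.integral_const, smul_eq_mul] at h3
  change step t 1 * _ ≤ _ at h3
  refine le_of_mul_le_mul_left ((h3.trans h2).trans_eq ?_) hτ
  ring

theorem kernelP_zero_le (hα₀ : 0 < α) (hα₁ : α < 1) (ht : IsTimeMesh N t)
    (hM1 : CondM1 α θ N t) (hn : 1 ≤ n) (hnN : n ≤ N) :
    kernelP (kernelA α θ t) n 0 ≤ 11 / 4 * (Real.Gamma (2 - α) * step t n ^ α) := by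
  have hτ := ht.step_pos hn hnN
  have h1 := (coeffA_zero_ge hα₀ hα₁ ht hM1.1 hn hnN).trans
    (kernelA_zero_ge hα₀ hα₁ ht (by linarith [hM1.1]) hn hnN)
  have hG : 0 < Real.Gamma (2 - α) := Real.Gamma_pos_of_pos (by linarith)
  have h2 := Real.rpow_pos_of_pos hτ α
  rw [Real.rpow_neg hτ.le] at h1
  rw [kernelP_zero]
  refine (one_div_le_one_div_of_le (by positivity) h1).trans_eq ?_
  field_simp

end KernelMoments

/-! ### The Mittag-Leffler function -/

section MittagLeffler

variable {α : ℝ}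

/-- Keep only `s > R` in the Gamma integral, where `s ^ x ≥ R ^ x`. The freedom in `R` gives
superexponential growth. -/
theorem one_div_Gamma_one_add_le {x R : ℝ} (hx : 0 ≤ x) (hR : 0 < R) :
    1 / Real.Gamma (1 + x) ≤ Real.exp R * R ^ (-x) := by
  have h1 : Real.exp (-R) * R ^ x ≤ Real.Gamma (1 + x) := by
    rw [Real.Gamma_eq_integral (by linarith)]
    have hint := Real.GammaIntegral_convergent (show 0 < 1 + x by linarith)
    calc Real.exp (-R) * R ^ x = ∫ s in Set.Ioi R, Real.exp (-s) * R ^ x := by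
          rw [MeasureTheory.integral_mul_const, integral_exp_neg_Ioi]
      _ ≤ ∫ s in Set.Ioi R, Real.exp (-s) * s ^ (1 + x - 1) := by
          refine MeasureTheory.setIntegral_mono_on
            ((integrableOn_exp_neg_Ioi R).mul_const _)
            (hint.mono_set (Set.Ioi_subset_Ioi hR.le)) measurableSet_Ioi fun s hs => ?_
          rw [add_sub_cancel_left]
          exact mul_le_mul_of_nonneg_left
            (Real.rpow_le_rpow hR.le (le_of_lt hs) hx) (Real.exp_pos _).le
      _ ≤ ∫ s in Set.Ioi 0, Real.exp (-s) * s ^ (1 + x - 1) := by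
          refine MeasureTheory.setIntegral_mono_set hint ?_
            (Set.Ioi_subset_Ioi hR.le).eventuallyLE
          filter_upwards [MeasureTheory.ae_restrict_mem measurableSet_Ioi] with s hs
          exact mul_nonneg (Real.exp_pos _).le (Real.rpow_nonneg (le_of_lt hs) _)
  have h2 : 0 < R ^ x := Real.rpow_pos_of_pos hR _
  refine (one_div_le_one_div_of_le (mul_pos (Real.exp_pos _) h2) h1).trans_eq ?_
  rw [Real.exp_neg, Real.rpow_neg hR.le]
  field_simp

theorem summable_mittagLeffler (hα₀ : 0 < α) {z : ℝ} (hz : 0 ≤ z) :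
    Summable fun k : ℕ => z ^ k / Real.Gamma (1 + k * α) := by
  -- Chosen so that `R ^ α = 2z + 1 > z`, giving a geometric majorant of ratio `z / (2z + 1)`.
  set R : ℝ := (2 * z + 1) ^ (1 / α) with hRdef
  have hR : 0 < R := Real.rpow_pos_of_pos (by linarith) _
  have hRα : R ^ α = 2 * z + 1 := by
    rw [hRdef, ← Real.rpow_mul (by linarith), one_div_mul_cancel hα₀.ne', Real.rpow_one]
  have hr : z / (2 * z + 1) < 1 := by rw [div_lt_one (by linarith)]; linarith
  refine Summable.of_nonneg_of_le
    (fun k => div_nonneg (pow_nonneg hz _) (Gamma_one_add_pos hα₀ k).le) (fun k => ?_)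
    ((summable_geometric_of_lt_one (div_nonneg hz (by linarith)) hr).mul_left (Real.exp R))
  have h1 := mul_le_mul_of_nonneg_left
    (one_div_Gamma_one_add_le (show 0 ≤ (k : ℝ) * α by positivity) hR) (pow_nonneg hz k)
  rw [mul_one_div] at h1
  refine h1.trans_eq ?_
  rw [Real.rpow_neg hR.le, mul_comm (k : ℝ), Real.rpow_mul_natCast hR.le, hRα, div_pow]
  field_simp

theorem mittagLeffler_nonneg (hα₀ : 0 < α) {z : ℝ} (hz : 0 ≤ z) : 0 ≤ mittagLeffler α z :=
  tsum_nonneg fun k => div_nonneg (pow_nonneg hz _) (Gamma_one_add_pos hα₀ k).le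

theorem mittagLeffler_zero (α : ℝ) : mittagLeffler α 0 = 1 := by
  rw [mittagLeffler, tsum_eq_single 0 (fun k hk => by simp [hk])]
  simp

theorem mittagLeffler_mono (hα₀ : 0 < α) {y z : ℝ} (hy : 0 ≤ y) (hyz : y ≤ z) :
    mittagLeffler α y ≤ mittagLeffler α z :=
  (summable_mittagLeffler hα₀ hy).tsum_le_tsum
    (fun k => div_le_div_of_nonneg_right (pow_le_pow_left₀ hy hyz k)
      (Gamma_one_add_pos hα₀ k).le) (summable_mittagLeffler hα₀ (hy.trans hyz))

theorem hasSum_mittagLeffler_powTerm (hα₀ : 0 < α) {c x : ℝ} (hc : 0 ≤ c) (hx : 0 ≤ x) :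
    HasSum (fun k : ℕ => c ^ k * powTerm α k x) (mittagLeffler α (c * x ^ α)) := by
  have h := (summable_mittagLeffler hα₀ (mul_nonneg hc (Real.rpow_nonneg hx α))).hasSum
  rw [mittagLeffler]
  convert h using 2 with k
  rw [powTerm, mul_pow, mul_comm (k : ℝ), Real.rpow_mul_natCast hx, mul_div_assoc]

/-- The prefactor `c` and the moment bound shift the Mittag-Leffler series by one index; the missing
zeroth term accounts for the `- 1`. -/
theorem sum_kernelP_mul_mittagLeffler_le {θ : ℝ} {N : ℕ} {t : ℕ → ℝ} {n : ℕ} (hα₀ : 0 < α)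
    (hα₁ : α < 1) (ht : IsTimeMesh N t) (hM1 : CondM1 α θ N t) (hn : 1 ≤ n) (hnN : n ≤ N)
    {c : ℝ} (hc : 0 ≤ c) :
    c * ∑ j ∈ Icc 1 (n - 1),
        kernelP (kernelA α θ t) n (n - j) * mittagLeffler α (c * t j ^ α) ≤
      77 / 16 * (mittagLeffler α (c * t n ^ α) - 1) := by
  have h1 : HasSum (fun k : ℕ => c * ∑ j ∈ Icc 1 (n - 1),
      kernelP (kernelA α θ t) n (n - j) * (c ^ k * powTerm α k (t j)))
      (c * ∑ j ∈ Icc 1 (n - 1),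
        kernelP (kernelA α θ t) n (n - j) * mittagLeffler α (c * t j ^ α)) := by
    refine (hasSum_sum fun j hj => ?_).mul_left c
    have hj' := mem_Icc.1 hj
    exact (hasSum_mittagLeffler_powTerm hα₀ hc (ht.nonneg (by omega))).mul_left _
  have h2 : HasSum (fun k : ℕ => 77 / 16 * (c ^ (k + 1) * powTerm α (k + 1) (t n)))
      (77 / 16 * (mittagLeffler α (c * t n ^ α) - 1)) := by
    have h3 := (hasSum_nat_add_iff' 1).2 (hasSum_mittagLeffler_powTerm hα₀ hc (ht.nonneg hnN))
    simp only [sum_range_one, pow_zero, one_mul] at h3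
    have h4 : powTerm α 0 (t n) = 1 := by simp [powTerm]
    rw [h4] at h3
    exact h3.mul_left _
  refine hasSum_le (fun k => ?_) h1 h2
  have h5 := mul_le_mul_of_nonneg_left (sum_kernelP_mul_powTerm_le hα₀ hα₁ ht hM1 hn hnN k)
    (show 0 ≤ c ^ (k + 1) by positivity)
  refine le_trans (le_of_eq ?_) (h5.trans_eq ?_)
  · rw [mul_sum, mul_sum]
    exact sum_congr rfl fun j _ => by ring
  · ring

end MittagLeffler

theorem le_maxUpTo {n : ℕ} (hn : 1 ≤ n) (g : ℕ → ℝ) {k : ℕ} (hk : 1 ≤ k) (hkn : k ≤ n) :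
    g k ≤ maxUpTo n hn g :=
  le_sup' g (mem_Icc.2 ⟨hk, hkn⟩)

theorem maxUpTo_le {n : ℕ} (hn : 1 ≤ n) {g : ℕ → ℝ} {c : ℝ} (h : ∀ k, 1 ≤ k → k ≤ n → g k ≤ c) :
    maxUpTo n hn g ≤ c :=
  sup'_le _ _ fun k hk => h k (mem_Icc.1 hk).1 (mem_Icc.1 hk).2

/-! ### The finite element space -/

section FiniteElement

open MeasureTheory

variable {d : ℕ} {Ω : Set (Space d)} {K : Geometry.SimplicialComplex ℝ (Space d)}

theorem smul_add_smul_mem_femSpace {v w : Space d → ℝ} (hv : v ∈ femSpace K Ω)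
    (hw : w ∈ femSpace K Ω) (a b : ℝ) : a • v + b • w ∈ femSpace K Ω := by
  refine ⟨(hv.1.const_smul a).add (hw.1.const_smul b), fun s hs hc => ?_, fun x hx => ?_⟩
  · obtain ⟨g, hg⟩ := hv.2.1 s hs hc
    obtain ⟨h, hh⟩ := hw.2.1 s hs hc
    refine ⟨a • g + b • h, fun x hx => ?_⟩
    simp [hg hx, hh hx]
  · simp [hv.2.2 x hx, hw.2.2 x hx]

theorem memLp_of_mem_femSpace (hΩ : Bornology.IsBounded Ω) {v : Space d → ℝ}
    (hv : v ∈ femSpace K Ω) : MemLp v 2 (volume.restrict Ω) := by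
  have hc : HasCompactSupport v := by
    refine HasCompactSupport.intro hΩ.isCompact_closure fun x hx => ?_
    exact hv.2.2 x fun h => hx (subset_closure h)
  exact (hv.1.memLp_of_hasCompactSupport hc).restrict Ω

theorem l2Inner_eq_inner {v w : Space d → ℝ} (hv : MemLp v 2 (volume.restrict Ω))
    (hw : MemLp w 2 (volume.restrict Ω)) :
    l2Inner Ω v w = inner ℝ (hv.toLp v) (hw.toLp w) := by
  rw [L2.inner_def, l2Inner]
  refine integral_congr_ae ?_
  filter_upwards [hv.coeFn_toLp, hw.coeFn_toLp] with x h1 h2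
  simp [h1, h2, mul_comm]

theorem l2Norm_eq_norm {v : Space d → ℝ} (hv : MemLp v 2 (volume.restrict Ω)) :
    l2Norm Ω v = ‖hv.toLp v‖ := by
  rw [l2Norm, l2Inner_eq_inner hv hv, real_inner_self_eq_norm_sq, Real.sqrt_sq (norm_nonneg _)]

theorem l2Norm_nonneg (Ω : Set (Space d)) (v : Space d → ℝ) : 0 ≤ l2Norm Ω v :=
  Real.sqrt_nonneg _

theorem gradInner_self_nonneg (Ω : Set (Space d)) (v : Space d → ℝ) : 0 ≤ gradInner Ω v v :=
  integral_nonneg fun _ => real_inner_self_nonneg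

theorem l2Inner_discreteCaputo {α θ : ℝ} {t : ℕ → ℝ} {v : ℕ → Space d → ℝ} {n : ℕ}
    (hv : ∀ k ≤ n, MemLp (v k) 2 (volume.restrict Ω)) {χ : Space d → ℝ}
    (hχ : MemLp χ 2 (volume.restrict Ω)) :
    l2Inner Ω (discreteCaputo α θ t v n) χ =
      ∑ k ∈ Icc 1 n, kernelA α θ t n (n - k) * (l2Inner Ω (v k) χ - l2Inner Ω (v (k - 1)) χ) := by
  have hint : ∀ k ≤ n, Integrable (fun x => v k x * χ x) (volume.restrict Ω) := fun k hk =>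
    (hv k hk).integrable_mul hχ
  simp only [l2Inner]
  have e : (fun x => discreteCaputo α θ t v n x * χ x) = fun x => ∑ k ∈ Icc 1 n,
      kernelA α θ t n (n - k) * (v k x * χ x - v (k - 1) x * χ x) := by
    ext x
    simp only [discreteCaputo, Finset.sum_apply, Pi.smul_apply, Pi.sub_apply, smul_eq_mul,
      sum_mul]
    exact sum_congr rfl fun k _ => by ring
  rw [e, integral_finsetSum]
  · refine sum_congr rfl fun k hk => ?_
    have hk' := mem_Icc.1 hk
    rw [integral_const_mul, integral_sub (hint k hk'.2) (hint (k - 1) (by omega))]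
  · intro k hk
    have hk' := mem_Icc.1 hk
    exact ((hint k hk'.2).sub (hint (k - 1) (by omega))).const_mul _

/-- The energy inequality of the fully discrete scheme. -/
theorem IsSchemeSolution.energy_le (hΩ : Bornology.IsBounded Ω) {α θ κ : ℝ} (hα₀ : 0 < α)
    (hα₁ : α < 1) {N : ℕ} {t : ℕ → ℝ} (ht : IsTimeMesh N t) (hM1 : CondM1 α θ N t)
    {f : ℝ → Space d → ℝ} {u₀ : Space d → ℝ} {u : ℕ → Space d → ℝ}
    (hu : IsSchemeSolution Ω K α θ κ N t f u₀ u) {n : ℕ} (hn : 1 ≤ n) (hnN : n ≤ N)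
    (hf : MemLp (f (offsetTime θ t n)) 2 (volume.restrict Ω)) :
    ∑ k ∈ Icc 1 n, kernelA α θ t n (n - k) *
        (l2Norm Ω (u k) ^ 2 - l2Norm Ω (u (k - 1)) ^ 2) ≤
      2 * max κ 0 * (θ * l2Norm Ω (u (n - 1)) + (1 - θ) * l2Norm Ω (u n)) ^ 2 +
        (θ * l2Norm Ω (u (n - 1)) + (1 - θ) * l2Norm Ω (u n)) *
          (2 * l2Norm Ω (f (offsetTime θ t n))) := by
  have hθ := hM1.1
  -- Membership in `X_h` is known only up to `N`; truncating the index gives an `L²` sequence on all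
  -- of `ℕ`.
  have hmem : ∀ k, MemLp (u (min k N)) 2 (volume.restrict Ω) := fun k =>
    memLp_of_mem_femSpace hΩ (hu.mem _ (min_le_right _ _))
  set X : ℕ → Lp ℝ 2 (volume.restrict Ω) := fun k => (hmem k).toLp _ with hX
  have hXk : ∀ k ≤ N, ∀ h : MemLp (u k) 2 (volume.restrict Ω), h.toLp (u k) = X k := by
    intro k hk h
    simp only [hX, min_eq_left hk]
  have hnorm : ∀ k ≤ N, l2Norm Ω (u k) = ‖X k‖ := fun k hk => by
    rw [l2Norm_eq_norm (memLp_of_mem_femSpace hΩ (hu.mem k hk)), hXk k hk]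
  have hm1 := memLp_of_mem_femSpace hΩ (hu.mem (n - 1) (by omega))
  have hm2 := memLp_of_mem_femSpace hΩ (hu.mem n hnN)
  have hχ : offsetValue θ u n ∈ femSpace K Ω :=
    smul_add_smul_mem_femSpace (hu.mem (n - 1) (by omega)) (hu.mem n hnN) _ _
  have hχm := memLp_of_mem_femSpace hΩ hχ
  set y := hχm.toLp _ with hy
  have hyX : y = θ • X (n - 1) + (1 - θ) • X n := by
    rw [← hXk _ (by omega) hm1, ← hXk _ hnN hm2, ← MemLp.toLp_const_smul,
      ← MemLp.toLp_const_smul, ← MemLp.toLp_add]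
    rfl
  have henergy := sum_mul_norm_sq_sub_le (θ := θ) (n := n) (a := kernelA α θ t n)
    (by linarith) (by linarith) (fun m hm => (kernelA_pos hα₀ hα₁ ht hM1 hm hnN).le)
    (fun m hm => kernelA_anti hα₀ hα₁ ht hM1 hnN hm)
    (fun h => kernelA_one_le hα₀ hα₁ ht hM1 h hnN) X
  rw [← hyX] at henergy
  have heq := hu.eqn n hn hnN _ hχ
  rw [l2Inner_discreteCaputo
    (fun k hk => memLp_of_mem_femSpace hΩ (hu.mem k (hk.trans hnN))) hχm,
    l2Inner_eq_inner hχm hχm, l2Inner_eq_inner hf hχm, real_inner_self_eq_norm_sq] at heq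
  have hsum : ∑ k ∈ Icc 1 n, kernelA α θ t n (n - k) *
      (l2Inner Ω (u k) (offsetValue θ u n) - l2Inner Ω (u (k - 1)) (offsetValue θ u n)) =
      inner ℝ (∑ k ∈ Icc 1 n, kernelA α θ t n (n - k) • (X k - X (k - 1))) y := by
    rw [sum_inner]
    refine sum_congr rfl fun k hk => ?_
    have hk' := mem_Icc.1 hk
    rw [l2Inner_eq_inner (memLp_of_mem_femSpace hΩ (hu.mem k (by omega))) hχm,
      l2Inner_eq_inner (memLp_of_mem_femSpace hΩ (hu.mem (k - 1) (by omega))) hχm,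
      hXk k (by omega), hXk (k - 1) (by omega), real_inner_smul_left, inner_sub_left]
  rw [hsum] at heq
  have hgrad := gradInner_self_nonneg Ω (offsetValue θ u n)
  have hfy := real_inner_le_norm (hf.toLp _) y
  have hκ := mul_le_mul_of_nonneg_right (le_max_left κ 0) (sq_nonneg ‖y‖)
  have hynorm : ‖y‖ ≤ θ * ‖X (n - 1)‖ + (1 - θ) * ‖X n‖ := by
    rw [hyX]
    refine (norm_add_le _ _).trans_eq ?_
    rw [norm_smul, norm_smul, Real.norm_of_nonneg (by linarith), Real.norm_of_nonneg (by linarith)]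
  have hsq := mul_le_mul_of_nonneg_left (pow_le_pow_left₀ (norm_nonneg y) hynorm 2)
    (le_max_right κ 0)
  have hfn := mul_le_mul_of_nonneg_left hynorm (norm_nonneg (hf.toLp _))
  rw [hnorm n hnN, hnorm (n - 1) (by omega), l2Norm_eq_norm hf]
  have hlhs : ∑ k ∈ Icc 1 n, kernelA α θ t n (n - k) *
      (l2Norm Ω (u k) ^ 2 - l2Norm Ω (u (k - 1)) ^ 2) =
      ∑ k ∈ Icc 1 n, kernelA α θ t n (n - k) * (‖X k‖ ^ 2 - ‖X (k - 1)‖ ^ 2) :=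
    sum_congr rfl fun k hk => by
      have hk' := mem_Icc.1 hk
      rw [hnorm k (by omega), hnorm (k - 1) (by omega)]
  rw [hlhs]
  linarith

end FiniteElement

/-! ### Consequences of the step restriction and bounds for the source term. -/

section Stability

variable {α θ κ : ℝ} {N : ℕ} {t : ℕ → ℝ} {n : ℕ}

/-- The restriction gives `τ^α ≤ 1 / (11 Γ(2-α) κ)`, and `11/4 · 2 · 1/11 = 1/2`. -/
theorem kernelP_zero_mul_le (hα₀ : 0 < α) (hα₁ : α < 1) (hN : 1 ≤ N) (ht : IsTimeMesh N t)
    (hM1 : CondM1 α θ N t) (hτ : 0 < κ → maxUpTo N hN (step t) ≤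
      1 / (11 * Real.Gamma (2 - α) * max κ 0) ^ (1 / α)) (hn : 1 ≤ n) (hnN : n ≤ N) :
    kernelP (kernelA α θ t) n 0 * (2 * max κ 0) ≤ 1 / 2 := by
  rcases le_or_gt κ 0 with hκ | hκ
  · rw [max_eq_right hκ]; norm_num
  have hG : 0 < Real.Gamma (2 - α) := Real.Gamma_pos_of_pos (by linarith)
  have h1 := (le_maxUpTo hN (step t) hn hnN).trans (hτ hκ)
  rw [max_eq_left hκ.le] at h1 ⊢
  have hb : 0 < 11 * Real.Gamma (2 - α) * κ := by positivity
  have h2 := Real.rpow_le_rpow (ht.step_pos hn hnN).le h1 hα₀.le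
  rw [Real.div_rpow zero_le_one (Real.rpow_nonneg hb.le _), Real.one_rpow,
    ← Real.rpow_mul hb.le, one_div_mul_cancel hα₀.ne', Real.rpow_one, le_div_iff₀ hb] at h2
  have h3 := mul_le_mul_of_nonneg_right (kernelP_zero_le hα₀ hα₁ ht hM1 hn hnN)
    (show 0 ≤ 2 * κ by positivity)
  linarith

/-- Write `t_j^(-α) = Γ(1-α) ω_{1-α}(t_j)` and round the moment bound `11/4` up to `3`. -/
theorem sum_kernelP_mul_le (hα₀ : 0 < α) (hα₁ : α < 1) (ht : IsTimeMesh N t)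
    (hM1 : CondM1 α θ N t) (hn : 1 ≤ n) (hnN : n ≤ N) {φ : ℕ → ℝ} {M : ℝ} (hM : 0 ≤ M)
    (hφ : ∀ j, 1 ≤ j → j ≤ n → t j ^ α * φ j ≤ M) :
    ∑ j ∈ Icc 1 n, kernelP (kernelA α θ t) n (n - j) * φ j ≤
      3 * Real.Gamma (1 - α) * M := by
  have hG : 0 < Real.Gamma (1 - α) := Real.Gamma_pos_of_pos (by linarith)
  have h1 : ∑ j ∈ Icc 1 n, kernelP (kernelA α θ t) n (n - j) * φ j ≤
      (∑ j ∈ Icc 1 n, kernelP (kernelA α θ t) n (n - j) * omega (1 - α) (t j)) *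
        (Real.Gamma (1 - α) * M) := by
    rw [sum_mul]
    refine sum_le_sum fun j hj => ?_
    have hj' := mem_Icc.1 hj
    have htj := ht.pos hj'.1 (hj'.2.trans hnN)
    rw [mul_assoc]
    refine mul_le_mul_of_nonneg_left ?_ (kernelP_kernelA_nonneg hα₀ hα₁ ht hM1 hnN (by omega))
    have h2 := Real.rpow_pos_of_pos htj α
    rw [omega_one_sub, Real.rpow_neg htj.le,
      show (t j ^ α)⁻¹ / Real.Gamma (1 - α) * (Real.Gamma (1 - α) * M) = M / t j ^ α by
        field_simp, le_div_iff₀ h2]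
    linarith [hφ j hj'.1 hj'.2]
  have h2 := mul_le_mul_of_nonneg_right (sum_kernelP_mul_omega_le hα₀ hα₁ ht hM1 hn hnN)
    (mul_nonneg hG.le hM)
  have h3 := mul_nonneg hG.le hM
  linarith

end Stability

end FracCN

/-! ### Assembly of the stability estimate. -/

theorem mainTheorem3
    (d : ℕ) (hd₁ : 1 ≤ d) (hd₃ : d ≤ 3)
    (Ω : Set (FracCN.Space d)) (hΩ_open : IsOpen Ω) (hΩ_conn : IsConnected Ω)
    (hΩ_bdd : Bornology.IsBounded Ω)
    (K : Geometry.SimplicialComplex ℝ (FracCN.Space d)) (hK : FracCN.IsTriangulation K Ω)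
    (α θ κ : ℝ) (hα₀ : 0 < α) (hα₁ : α < 1)
    (N : ℕ) (hN : 1 ≤ N) (t : ℕ → ℝ) (ht : FracCN.IsTimeMesh N t)
    (hM1 : FracCN.CondM1 α θ N t)
    (hτ : 0 < κ → FracCN.maxUpTo N hN (FracCN.step t) ≤
      1 / (11 * Real.Gamma (2 - α) * max κ 0) ^ (1 / α))
    (f : ℝ → FracCN.Space d → ℝ)
    (hf : ∀ n, 1 ≤ n → n ≤ N →
      MeasureTheory.MemLp (f (FracCN.offsetTime θ t n)) 2
        (MeasureTheory.volume.restrict Ω))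
    (u₀ : FracCN.Space d → ℝ) (u : ℕ → FracCN.Space d → ℝ)
    (hu : FracCN.IsSchemeSolution Ω K α θ κ N t f u₀ u) :
    ∀ (n : ℕ) (hn : 1 ≤ n), n ≤ N →
      FracCN.l2Norm Ω (u n) ≤
          2 * FracCN.mittagLeffler α (20 * max κ 0 * t n ^ α) *
            (FracCN.l2Norm Ω u₀ +
              2 * FracCN.maxUpTo n hn (fun k => ∑ j ∈ Finset.Icc 1 k,
                FracCN.kernelP (FracCN.kernelA α θ t) k (k - j) *
                  FracCN.l2Norm Ω (f (FracCN.offsetTime θ t j)))) ∧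
        2 * FracCN.mittagLeffler α (20 * max κ 0 * t n ^ α) *
            (FracCN.l2Norm Ω u₀ +
              2 * FracCN.maxUpTo n hn (fun k => ∑ j ∈ Finset.Icc 1 k,
                FracCN.kernelP (FracCN.kernelA α θ t) k (k - j) *
                  FracCN.l2Norm Ω (f (FracCN.offsetTime θ t j)))) ≤
          2 * FracCN.mittagLeffler α (20 * max κ 0 * t n ^ α) *
            (FracCN.l2Norm Ω u₀ +
              6 * Real.Gamma (1 - α) * FracCN.maxUpTo n hn (fun j =>
                t j ^ α * FracCN.l2Norm Ω (f (FracCN.offsetTime θ t j)))) := by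

  intro n hn hnN
  have hθ := hM1.1
  have hκ : 0 ≤ 20 * max κ 0 := mul_nonneg (by norm_num) (le_max_right _ _)
  set φ : ℕ → ℝ := fun j => FracCN.l2Norm Ω (f (FracCN.offsetTime θ t j)) with hφ
  have hφ₀ : ∀ j, 0 ≤ φ j := fun j => FracCN.l2Norm_nonneg _ _
  have hφn : ∀ j, FracCN.l2Norm Ω (f (FracCN.offsetTime θ t j)) = φ j := fun _ => rfl
  simp only [hφn]
  set S : ℕ → ℝ := fun k => ∑ j ∈ Finset.Icc 1 k,
    FracCN.kernelP (FracCN.kernelA α θ t) k (k - j) * φ j with hS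
  set E : ℕ → ℝ := fun k => FracCN.mittagLeffler α (20 * max κ 0 * t k ^ α) with hE
  have hpow : ∀ k ≤ N, 0 ≤ 20 * max κ 0 * t k ^ α := fun k hk =>
    mul_nonneg hκ (Real.rpow_nonneg (ht.nonneg hk) α)
  constructor
  · have hS₁ : 0 ≤ S 1 := Finset.sum_nonneg fun j hj => by
      have hj' := Finset.mem_Icc.1 hj
      exact mul_nonneg (FracCN.kernelP_kernelA_nonneg hα₀ hα₁ ht hM1 hN (by omega)) (hφ₀ j)
    refine FracCN.discrete_gronwall (A := FracCN.kernelA α θ t) (n := n) (θ := θ)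
      (Λ := 2 * max κ 0) (v := fun k => FracCN.l2Norm Ω (u k)) (g := fun j => 2 * φ j) (E := E)
      (fun j h1 h2 => FracCN.kernelA_pos hα₀ hα₁ ht hM1 h1 (h2.trans hnN))
      (fun j m h1 h2 => FracCN.kernelA_anti hα₀ hα₁ ht hM1 (h1.trans hnN) h2)
      (by linarith) (by linarith) (by linarith) (fun k => FracCN.l2Norm_nonneg _ _)
      (fun k => mul_nonneg zero_le_two (hφ₀ k)) ?_ ?_ ?_ ?_ ?_ ?_ ?_ n le_rfl
    · intro j k hjk hk
      exact FracCN.mittagLeffler_mono hα₀ (hpow j (by omega)) (mul_le_mul_of_nonneg_left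
        (Real.rpow_le_rpow (ht.nonneg (by omega)) (ht.mono hjk (by omega)) hα₀.le) hκ)
    · simp only [hE, ht.1, Real.zero_rpow hα₀.ne', mul_zero, FracCN.mittagLeffler_zero, le_refl]
    -- This fixes the constant `20`: here `2Λ = 4κ₊`, and `4 · 77/16 = 77/4 ≤ 20`.
    · intro k hk hkn
      have h1 := FracCN.sum_kernelP_mul_mittagLeffler_le hα₀ hα₁ ht hM1 hk (hkn.trans hnN) hκ
      have h2 : 1 ≤ E k := by
        rw [← FracCN.mittagLeffler_zero α]
        exact FracCN.mittagLeffler_mono hα₀ le_rfl (hpow k (by omega))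
      simp only [hE] at h2 ⊢
      linarith
    · intro k hk hkn
      exact FracCN.kernelP_zero_mul_le hα₀ hα₁ hN ht hM1 hτ hk (hkn.trans hnN)
    · intro j hj hjn
      exact hu.energy_le hΩ_bdd hα₀ hα₁ ht hM1 hj (hjn.trans hnN) (hf j hj (hjn.trans hnN))
    -- Nonnegativity of `S 1` makes the maximum nonnegative, so the initial norm is at most `F`.
    · have h1 := FracCN.le_maxUpTo hn S le_rfl hn
      simp only [hu.init]
      linarith
    · intro k hk hkn
      have h1 := FracCN.le_maxUpTo hn S hk hkn
      have h2 : ∑ j ∈ Finset.Icc 1 k, FracCN.kernelP (FracCN.kernelA α θ t) k (k - j) *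
          (2 * φ j) = 2 * S k := by
        rw [hS, Finset.mul_sum]
        exact Finset.sum_congr rfl fun j _ => by ring
      simp only [hu.init]
      rw [h2]
      linarith
  · have hmax := fun j (hj : 1 ≤ j) (hjn : j ≤ n) =>
      FracCN.le_maxUpTo hn (fun j => t j ^ α * φ j) hj hjn
    have hmax₀ : 0 ≤ FracCN.maxUpTo n hn (fun j => t j ^ α * φ j) :=
      (mul_nonneg (Real.rpow_nonneg (ht.nonneg hN) α) (hφ₀ 1)).trans (hmax 1 le_rfl hn)
    have h1 : FracCN.maxUpTo n hn S ≤ 3 * Real.Gamma (1 - α) *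
        FracCN.maxUpTo n hn (fun j => t j ^ α * φ j) :=
      FracCN.maxUpTo_le hn fun k hk hkn =>
        FracCN.sum_kernelP_mul_le hα₀ hα₁ ht hM1 hk (hkn.trans hnN) hmax₀
          fun j hj hjk => hmax j hj (hjk.trans hkn)
    refine mul_le_mul_of_nonneg_left ?_
      (mul_nonneg zero_le_two (FracCN.mittagLeffler_nonneg hα₀ (hpow n hnN)))
    linarith
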